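/- For integers $k,l\ge 0$ let $S_k^{(1)}(l)$ be the (signed) Stirling numbers of the first kind, defined by $x(x+1)\cdots(x+k-1)=(-1)^k\sum_{l=0}^{k}(-1)^lS_k^{(1)}(l)\,x^l$ (and $S_k^{(1)}(l)=0$ for $l>k$). Let $B_k$ be the Bernoulli numbers, $\frac{x}{e^x-1}=\sum_{k\ge0}\frac{B_k}{k!}x^k$, let $\gamma$ be Euler's constant and $\gamma_1=\lim_{N\to\infty}\left(\sum_{k=1}^{N}\frac{\log k}{k}-\frac{(\log N)^2}{2}\right)$ the first Stieltjes constant. For $k\ge 1$ put $$a_k=(-1)^k\sum_{l=1}^{k}\frac{(-1)^l}{(l+2)!}B_{l+2}S_{l+1}^{(1)}(2)S_k^{(1)}(l),\qquad b_k=(-1)^k\sum_{l=1}^{k}\frac{1}{(l+1)(l+2)}B_{l+2}S_k^{(1)}(l),$$ and $$C=\frac{\gamma^2}{2}-\frac{\pi^2}{24}-\frac{(\log 2)^2}{2}-\log 2\,\log\pi-\frac{(\log\pi)^2}{2}+\gamma_1 .$$ Then for every integer $n\ge 1$ the two series below converge absolutely and $$\sum_{k=1}^{n}(\log k)^2=n(\log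 n)^2-2n\log n+2n+\frac12(\log n)^2+\frac{\log n}{6n}+C+2\sum_{k=1}^{\infty}\frac{a_k}{n(n+1)\cdots(n+k)}+2\log n\sum_{k=1}^{\infty}\frac{b_k}{n(n+1)\cdots(n+k)} .$$ The first coefficients are $2a_1=0$, $2a_2=\frac1{120}$, $2a_3=\frac1{40}$, $2a_4=\frac{167}{1890}$, $2a_5=\frac{145}{378}$ and $2b_1=0$, $2b_2=-\frac1{180}$, $2b_3=-\frac1{60}$, $2b_4=-\frac5{84}$, $2b_5=-\frac{11}{42}$. -/

import Mathlib

open Filter Topology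

/-- The signed Stirling number of the first kind `S_k^{(1)}(l)`: the connecting coefficient in
`(x)_k = (-1)^k ∑_{l=0}^k (-1)^l S_k^{(1)}(l) x^l`, where
`(x)_k = x (x+1) ⋯ (x+k-1)` is the rising factorial (Mathlib's `ascPochhammer`). -/
noncomputable def stirlingS (k l : ℕ) : ℤ :=
  (-1) ^ (k + l) * (ascPochhammer ℤ k).coeff l

/-- The identity which defines the Stirling numbers of the first kind. -/
theorem ascPochhammer_eq_sum_stirlingS (k : ℕ) (x : ℤ) :
    (ascPochhammer ℤ k).eval x
      = (-1) ^ k * ∑ l ∈ Finset.range (k + 1), (-1) ^ l * stirlingS k l * x ^ l := by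
  rw [Polynomial.eval_eq_sum_range, ascPochhammer_natDegree, Finset.mul_sum]
  refine Finset.sum_congr rfl fun l _ => ?_
  have h : ((-1 : ℤ) ^ k * (-1) ^ l) * ((-1) ^ k * (-1) ^ l) = 1 := by
    rw [← pow_add, ← pow_add, Even.neg_one_pow ⟨k + l, rfl⟩]
  unfold stirlingS
  rw [pow_add]
  linear_combination (-(ascPochhammer ℤ k).coeff l * x ^ l) * h

/-- The sequence `∑_{k=1}^{N} log k / k - (log N)² / 2`. -/
noncomputable def stieltjesSeqOne (N : ℕ) : ℝ :=
  (∑ k ∈ Finset.Icc 1 N, Real.log k / k) - Real.log N ^ 2 / 2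

/-- The first Stieltjes constant
`γ₁ = lim_{N → ∞} (∑_{k=1}^{N} log k / k - (log N)² / 2)`. -/
noncomputable def stieltjesGammaOne : ℝ := limUnder atTop stieltjesSeqOne

/-- For `3 ≤ x`, the increment of `(log x)² / 2` over `[x, x + 1]` lies between the values of
`log x / x` at the endpoints. -/
theorem half_log_sq_increment {x : ℝ} (hx : 3 ≤ x) :
    Real.log (x + 1) / (x + 1) ≤ Real.log (x + 1) ^ 2 / 2 - Real.log x ^ 2 / 2 ∧
      Real.log (x + 1) ^ 2 / 2 - Real.log x ^ 2 / 2 ≤ Real.log x / x := by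
  have hd : ∀ y : ℝ, 0 < y → HasDerivAt (fun t => Real.log t ^ 2 / 2) (Real.log y / y) y := by
    intro y hy
    have h := ((Real.hasDerivAt_log hy.ne').pow 2).div_const 2
    refine h.congr_deriv ?_
    simp only [Nat.cast_ofNat, Nat.add_one_sub_one, pow_one]
    field_simp
  obtain ⟨c, hc, hc'⟩ := exists_hasDerivAt_eq_slope (fun t => Real.log t ^ 2 / 2)
    (fun y => Real.log y / y) (show x < x + 1 by linarith)
    (fun y hy => (hd y (by linarith [hy.1])).continuousAt.continuousWithinAt)
    (fun y hy => hd y (by linarith [hy.1]))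
  have he : Real.exp 1 ≤ 3 := by linarith [Real.exp_one_lt_d9]
  have hc'' : Real.log c / c = Real.log (x + 1) ^ 2 / 2 - Real.log x ^ 2 / 2 := by
    rw [hc']; ring
  rw [← hc'']
  have hx1 : x ∈ Set.Ici (Real.exp 1) := Set.mem_Ici.2 (by linarith)
  have hc1 : c ∈ Set.Ici (Real.exp 1) := Set.mem_Ici.2 (by linarith [hc.1])
  have hy1 : x + 1 ∈ Set.Ici (Real.exp 1) := Set.mem_Ici.2 (by linarith)
  exact ⟨Real.log_div_self_antitoneOn hc1 hy1 hc.2.le,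
    Real.log_div_self_antitoneOn hx1 hc1 hc.1.le⟩

/-- The limit which defines `γ₁` exists, so `stieltjesGammaOne` is that limit. -/
theorem tendsto_stieltjesSeqOne : Tendsto stieltjesSeqOne atTop (𝓝 stieltjesGammaOne) := by
  have hsucc : ∀ N : ℕ, stieltjesSeqOne (N + 1) = stieltjesSeqOne N
      + Real.log ((N : ℝ) + 1) / ((N : ℝ) + 1)
      - (Real.log ((N : ℝ) + 1) ^ 2 / 2 - Real.log (N : ℝ) ^ 2 / 2) := by
    intro N
    unfold stieltjesSeqOne
    rw [Finset.sum_Icc_succ_top (by omega)]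
    push_cast
    ring
  have h3 : ∀ N : ℕ, (3 : ℝ) ≤ ((N + 3 : ℕ) : ℝ) := fun N => by
    push_cast; linarith [Nat.cast_nonneg (α := ℝ) N]
  have hanti : Antitone (fun N : ℕ => stieltjesSeqOne (N + 3)) := by
    refine antitone_nat_of_succ_le fun N => ?_
    rw [show N + 1 + 3 = (N + 3) + 1 by ring, hsucc (N + 3)]
    linarith [(half_log_sq_increment (h3 N)).1]
  have hmono : Monotone (fun N : ℕ => stieltjesSeqOne (N + 3)
      - Real.log ((N + 3 : ℕ) : ℝ) / ((N + 3 : ℕ) : ℝ)) := by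
    refine monotone_nat_of_le_succ fun N => ?_
    rw [show N + 1 + 3 = (N + 3) + 1 by ring, hsucc (N + 3), Nat.cast_succ (N + 3)]
    linarith [(half_log_sq_increment (h3 N)).2]
  have hbdd : BddBelow (Set.range fun N : ℕ => stieltjesSeqOne (N + 3)) := by
    refine ⟨stieltjesSeqOne 3 - Real.log ((3 : ℕ) : ℝ) / ((3 : ℕ) : ℝ), ?_⟩
    rintro _ ⟨N, rfl⟩
    have h := hmono (Nat.zero_le N)
    have hpos : 0 ≤ Real.log ((N + 3 : ℕ) : ℝ) / ((N + 3 : ℕ) : ℝ) :=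
      div_nonneg (Real.log_natCast_nonneg _) (Nat.cast_nonneg _)
    simp only [Nat.zero_add] at h
    show _ ≤ stieltjesSeqOne (N + 3)
    linarith
  have h := (tendsto_add_atTop_iff_nat 3).1 (tendsto_atTop_ciInf hanti hbdd)
  rwa [stieltjesGammaOne, h.limUnder_eq]

/-- `(-1)^k ∑_{l=1}^k (-1)^l / (l+2)! · B_{l+2} S_{l+1}^{(1)}(2) S_k^{(1)}(l)`. -/
noncomputable def plainCoeff (k : ℕ) : ℝ :=
  (-1) ^ k * ∑ l ∈ Finset.Icc 1 k,
    (-1) ^ l / ((l + 2).factorial : ℝ) * ((bernoulli (l + 2) : ℚ) : ℝ)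
      * (stirlingS (l + 1) 2 : ℝ) * (stirlingS k l : ℝ)

/-- `(-1)^k ∑_{l=1}^k 1 / ((l+1)(l+2)) · B_{l+2} S_k^{(1)}(l)`. -/
noncomputable def logCoeff (k : ℕ) : ℝ :=
  (-1) ^ k * ∑ l ∈ Finset.Icc 1 k,
    1 / (((l : ℝ) + 1) * ((l : ℝ) + 2)) * ((bernoulli (l + 2) : ℚ) : ℝ) * (stirlingS k l : ℝ)

/-- The product `n (n+1) (n+2) ⋯ (n+k)`. -/
noncomputable def risingProd (n k : ℕ) : ℝ := ∏ j ∈ Finset.range (k + 1), ((n : ℝ) + (j : ℝ))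

/-!
Let `D n` be the difference between `∑_{k ≤ n} (log k)²` and `∫_0^n (log t)² dt + (log n)² / 2`.
Integration by parts gives `D n - D (n + 1) = 2 ∫_0^1 (1/2 - y) f (n + y) dy` with
`f x = log x / x`. Expand `f (n + y)` in its Newton series `∑ (-y)_k (-1)^k Δ^k f (n) / k!`. The
integral of `(1/2 - y) (-y)_{k+1}` is `(k + 1) b_k`, where `b_k` is the value at the rising
factorial `(X)_k` of the linear functional `X^l ↦ B_{l+2} / ((l+1)(l+2))`. Hence the right-hand side
telescopes, and `D n = C + 2 ∑ b_k (-1)^k Δ^k f (n) / k!` with `C = lim D n`.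

The difference `(-1)^k Δ^k f (x) / k!` is `log x / (x)_{k+1}` plus a logarithm-free part. The
latter has a factorial series in `x` whose coefficients are the entries of the operator
`X^l ↦ -H_l X^l`, `H_l` the harmonic number, in the basis of the rising factorials. The off-diagonal
entries are nonnegative, which gives the absolute convergence needed to sum over `k` first; since
`S_{l+1}^{(1)}(2)` is `l! H_l` up to sign, this produces the coefficients `a_k`.

For the constant, let `ζ₁ s = (s - 1) ζ s`. Trapezoidal approximants to the zeta series express
`lim D n` through the derivatives of `ζ₁` at `0` up to the second, and `γ` and `γ₁` through those at
`1`; comparing second derivatives in the functional equation relates the two.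
-/

section SecondJet

variable {𝕜 : Type*} [NontriviallyNormedField 𝕜] {f g : 𝕜 → 𝕜} {a b c a' b' c' z : 𝕜}

/-- `f` is analytic at `z` with second-order jet `(a, b, c)`: the numbers `a`, `b` and `c` are the
values at `z` of `f` and of its first two derivatives (not divided by factorials). -/
structure HasSecondJetAt (f : 𝕜 → 𝕜) (a b c z : 𝕜) : Prop where
  analyticAt : AnalyticAt 𝕜 f z
  apply_eq : f z = a
  deriv_eq : deriv f z = b
  deriv_deriv_eq : deriv (deriv f) z = c

namespace HasSecondJetAt

lemma of_analyticAt (hf : AnalyticAt 𝕜 f z) :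
    HasSecondJetAt f (f z) (deriv f z) (deriv (deriv f) z) z :=
  ⟨hf, rfl, rfl, rfl⟩

lemma const (a z : 𝕜) : HasSecondJetAt (fun _ => a) a 0 0 z :=
  ⟨analyticAt_const, rfl, by simp, by simp⟩

lemma sub_const (a z : 𝕜) : HasSecondJetAt (fun w => w - a) (z - a) 1 0 z :=
  ⟨by fun_prop, rfl, by simp, by simp⟩

lemma congr (hf : HasSecondJetAt f a b c z) (h : f =ᶠ[𝓝 z] g) : HasSecondJetAt g a b c z :=
  ⟨hf.analyticAt.congr h, h.eq_of_nhds ▸ hf.apply_eq, h.deriv_eq ▸ hf.deriv_eq,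
    h.deriv.deriv_eq ▸ hf.deriv_deriv_eq⟩

lemma comp_affine {p q w : 𝕜} (hf : HasSecondJetAt f a b c w) (hw : p * z + q = w) :
    HasSecondJetAt (fun x => f (p * x + q)) a (p * b) (p ^ 2 * c) z := by
  subst hw
  obtain ⟨hfa, rfl, rfl, rfl⟩ := hf
  have deriv_comp (h : 𝕜 → 𝕜) :
      deriv (fun x => h (p * x + q)) = fun x => p * deriv h (p * x + q) := by
    ext x
    rw [deriv_comp_mul_left p (fun y => h (y + q)), smul_eq_mul, deriv_comp_add_const]
  refine ⟨hfa.fun_comp (f := fun x => p * x + q) (by fun_prop), rfl, by rw [deriv_comp], ?_⟩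
  rw [deriv_comp, deriv_const_mul_field, deriv_comp, sq, mul_assoc]

variable [CompleteSpace 𝕜]

lemma add (hf : HasSecondJetAt f a b c z) (hg : HasSecondJetAt g a' b' c' z) :
    HasSecondJetAt (fun w => f w + g w) (a + a') (b + b') (c + c') z := by
  obtain ⟨hfa, rfl, rfl, rfl⟩ := hf
  obtain ⟨hga, rfl, rfl, rfl⟩ := hg
  have deriv_add_eventuallyEq : deriv (fun w => f w + g w) =ᶠ[𝓝 z] deriv f + deriv g := by
    filter_upwards [hfa.eventually_analyticAt, hga.eventually_analyticAt] with w hfw hgw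
    exact deriv_fun_add hfw.differentiableAt hgw.differentiableAt
  refine ⟨hfa.add hga, rfl, deriv_add_eventuallyEq.eq_of_nhds, ?_⟩
  rw [deriv_add_eventuallyEq.deriv_eq,
    deriv_add hfa.deriv.differentiableAt hga.deriv.differentiableAt]

lemma mul (hf : HasSecondJetAt f a b c z) (hg : HasSecondJetAt g a' b' c' z) :
    HasSecondJetAt (fun w => f w * g w) (a * a') (b * a' + a * b')
      (c * a' + 2 * b * b' + a * c') z := by
  obtain ⟨hfa, rfl, rfl, rfl⟩ := hf
  obtain ⟨hga, rfl, rfl, rfl⟩ := hg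
  have deriv_mul_eventuallyEq :
      deriv (fun w => f w * g w) =ᶠ[𝓝 z] deriv f * g + f * deriv g := by
    filter_upwards [hfa.eventually_analyticAt, hga.eventually_analyticAt] with w hfw hgw
    exact deriv_fun_mul hfw.differentiableAt hgw.differentiableAt
  refine ⟨hfa.mul hga, rfl, deriv_mul_eventuallyEq.eq_of_nhds, ?_⟩
  have deriv_left := hfa.deriv.differentiableAt.hasDerivAt.mul hga.differentiableAt.hasDerivAt
  have deriv_right := hfa.differentiableAt.hasDerivAt.mul hga.deriv.differentiableAt.hasDerivAt
  rw [deriv_mul_eventuallyEq.deriv_eq, (deriv_left.add deriv_right).deriv]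
  ring

lemma const_mul (p : 𝕜) (hf : HasSecondJetAt f a b c z) :
    HasSecondJetAt (fun w => p * f w) (p * a) (p * b) (p * c) z := by
  simpa using (const p z).mul hf

lemma sum {ι : Type*} {s : Finset ι} {F : ι → 𝕜 → 𝕜} {A B C : ι → 𝕜}
    (hF : ∀ i ∈ s, HasSecondJetAt (F i) (A i) (B i) (C i) z) :
    HasSecondJetAt (fun w => ∑ i ∈ s, F i w) (∑ i ∈ s, A i) (∑ i ∈ s, B i) (∑ i ∈ s, C i) z := by
  induction s using Finset.cons_induction with
  | empty => simpa using const (0 : 𝕜) z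
  | cons i s his ih =>
    simp only [Finset.sum_cons]
    exact (hF i (Finset.mem_cons_self i s)).add (ih fun j hj => hF j (Finset.mem_cons_of_mem hj))

end HasSecondJetAt

end SecondJet

lemma hasSecondJetAt_const_cpow_sub {a : ℂ} (ha : a ≠ 0) (p z : ℂ) :
    HasSecondJetAt (fun s => a ^ (p - s)) (a ^ (p - z)) (-(a ^ (p - z) * Complex.log a))
      (a ^ (p - z) * Complex.log a ^ 2) z := by
  have hasDerivAt_cpow (w : ℂ) :
      HasDerivAt (fun s => a ^ (p - s)) (-(a ^ (p - w) * Complex.log a)) w :=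
    (((hasDerivAt_id w).const_sub p).const_cpow (Or.inl ha)).congr_deriv (by simp)
  have deriv_cpow :
      deriv (fun s => a ^ (p - s)) = fun w => -(a ^ (p - w) * Complex.log a) :=
    funext fun w => (hasDerivAt_cpow w).deriv
  refine ⟨Differentiable.analyticAt (fun w => (hasDerivAt_cpow w).differentiableAt) z, rfl,
    (hasDerivAt_cpow z).deriv, ?_⟩
  rw [deriv_cpow, ((hasDerivAt_cpow z).mul_const (Complex.log a)).fun_neg.deriv]
  ring

lemma hasSecondJetAt_const_cpow_neg {a : ℂ} (ha : a ≠ 0) (z : ℂ) :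
    HasSecondJetAt (fun s => a ^ (-s)) (a ^ (-z)) (-(a ^ (-z) * Complex.log a))
      (a ^ (-z) * Complex.log a ^ 2) z := by
  simpa only [zero_sub] using hasSecondJetAt_const_cpow_sub ha 0 z

/-- The entire function `sin z / z`, with the value `1` at the origin. -/
noncomputable def entireSinc : ℂ → ℂ := dslope Complex.sin 0

lemma mul_entireSinc (z : ℂ) : z * entireSinc z = Complex.sin z := by
  simpa [entireSinc] using sub_smul_dslope Complex.sin 0 z

lemma entireSinc_zero : entireSinc 0 = 1 := by
  simp [entireSinc]

lemma differentiable_entireSinc : Differentiable ℂ entireSinc :=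
  differentiableOn_univ.1 <|
    (Complex.differentiableOn_dslope univ_mem).2 Complex.differentiable_sin.differentiableOn

lemma entireSinc_two_mul (z : ℂ) : entireSinc (2 * z) = entireSinc z * Complex.cos z := by
  rcases eq_or_ne z 0 with rfl | hz
  · simp
  · refine mul_left_cancel₀ (mul_ne_zero two_ne_zero hz) ?_
    rw [mul_entireSinc, Complex.sin_two_mul, ← mul_entireSinc z]
    ring

-- Comparing jets in `sinc (2 z) = sinc z * cos z` determines the derivatives of `sinc` at `0`.
lemma hasSecondJetAt_entireSinc_zero : HasSecondJetAt entireSinc 1 0 (-1 / 3) 0 := by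
  have jet_cos : HasSecondJetAt Complex.cos 1 0 (-1) 0 :=
    ⟨Complex.differentiable_cos.analyticAt 0, by simp, by simp,
      by simp [Complex.deriv_cos']⟩
  have jet := HasSecondJetAt.of_analyticAt (differentiable_entireSinc.analyticAt 0)
  have jet_two_mul := (jet.comp_affine (p := 2) (q := 0) (z := 0) (by simp)).congr
    (.of_forall fun z => (congrArg entireSinc (add_zero _)).trans (entireSinc_two_mul z))
  have jet_mul := jet.mul jet_cos
  rw [entireSinc_zero] at jet jet_mul
  have deriv_zero : deriv entireSinc 0 = 0 := by
    linear_combination jet_two_mul.deriv_eq.symm.trans jet_mul.deriv_eq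
  refine ⟨jet.analyticAt, entireSinc_zero, deriv_zero, ?_⟩
  linear_combination (jet_two_mul.deriv_deriv_eq.symm.trans jet_mul.deriv_deriv_eq) / 3

lemma analyticAt_Gamma {z : ℂ} (hz : ∀ m : ℕ, z ≠ -m) : AnalyticAt ℂ Complex.Gamma z := by
  have h := (Complex.differentiable_one_div_Gamma.analyticAt z).inv
    (inv_ne_zero (Complex.Gamma_ne_zero hz))
  rwa [show (fun s => (Complex.Gamma s)⁻¹)⁻¹ = Complex.Gamma from inv_inv _] at h

lemma Gamma_one_add_mul_Gamma_one_sub_mul_entireSinc {z : ℂ} (hz : ‖z‖ < 1) :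
    Complex.Gamma (1 + z) * Complex.Gamma (1 - z) * entireSinc (Real.pi * z) = 1 := by
  rcases eq_or_ne z 0 with rfl | hz0
  · simp [entireSinc_zero]
  have hpi : (Real.pi : ℂ) ≠ 0 := Complex.ofReal_ne_zero.2 Real.pi_ne_zero
  have hsin : Complex.sin (Real.pi * z) ≠ 0 := by
    intro h
    obtain ⟨m, hm⟩ := Complex.sin_eq_zero_iff.1 h
    obtain rfl : z = m := mul_left_cancel₀ hpi (by rw [hm, mul_comm])
    rw [Complex.norm_intCast] at hz
    exact hz0 (by exact_mod_cast Int.abs_lt_one_iff.1 (by exact_mod_cast hz))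
  have reflection := Complex.Gamma_mul_Gamma_one_sub z
  rw [eq_div_iff hsin, ← mul_entireSinc] at reflection
  rw [add_comm, Complex.Gamma_add_one z hz0]
  refine mul_left_cancel₀ hpi ?_
  linear_combination reflection

lemma hasSecondJetAt_Gamma_one :
    HasSecondJetAt Complex.Gamma 1 (-Real.eulerMascheroniConstant)
      (Real.eulerMascheroniConstant ^ 2 + Real.pi ^ 2 / 6) 1 := by
  have analyticAt_one : AnalyticAt ℂ Complex.Gamma 1 := analyticAt_Gamma fun m hm => by
    have := congrArg Complex.re hm
    simp only [Complex.one_re, Complex.neg_re, Complex.natCast_re] at this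
    linarith [m.cast_nonneg (α := ℝ)]
  have jet : HasSecondJetAt Complex.Gamma 1 (-Real.eulerMascheroniConstant)
      (deriv (deriv Complex.Gamma) 1) 1 :=
    ⟨analyticAt_one, Complex.Gamma_one, Complex.hasDerivAt_Gamma_one.deriv, rfl⟩
  have jet_reflection := ((jet.comp_affine (p := 1) (q := 1) (z := 0) (by simp)).mul
    (jet.comp_affine (p := -1) (q := 1) (z := 0) (by simp))).mul
    (hasSecondJetAt_entireSinc_zero.comp_affine (p := (Real.pi : ℂ)) (q := 0) (z := 0) (by simp))
  have norm_lt_one : ∀ᶠ z : ℂ in 𝓝 0, ‖z‖ < 1 := by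
    simpa using eventually_norm_sub_lt (0 : ℂ) one_pos
  have jet_one := jet_reflection.congr (g := fun _ => 1) <| norm_lt_one.mono fun z hz => by
    simpa only [one_mul, neg_one_mul, add_zero, neg_add_eq_sub, add_comm z] using
      Gamma_one_add_mul_Gamma_one_sub_mul_entireSinc hz
  refine ⟨jet.analyticAt, jet.apply_eq, jet.deriv_eq, ?_⟩
  linear_combination (jet_one.deriv_deriv_eq.symm.trans
    (HasSecondJetAt.const 1 0).deriv_deriv_eq) / 2

lemma riemannZeta₁_eq_sub_mul {s : ℂ} (hs : s ≠ 1) :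
    riemannZeta₁ s = (s - 1) * riemannZeta s := by
  rw [riemannZeta_eq_inv_sub_mul hs, mul_inv_cancel_left₀ (sub_ne_zero.2 hs)]

lemma riemannZeta₁_neg {z : ℂ} (hz : ‖z‖ < 1) :
    riemannZeta₁ (-z) = (z + 1) * (2 * Real.pi : ℂ) ^ (-z) * Complex.Gamma (z + 1) *
      entireSinc (Real.pi / 2 * z) * (1 / 2 * riemannZeta₁ (z + 1)) := by
  have hpi : (Real.pi : ℂ) ≠ 0 := Complex.ofReal_ne_zero.2 Real.pi_ne_zero
  rcases eq_or_ne z 0 with rfl | hz0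
  · rw [neg_zero, riemannZeta₁_eq_sub_mul zero_ne_one, riemannZeta_zero]
    norm_num [entireSinc_zero]
  have add_one_ne_one : z + 1 ≠ 1 := by simpa using hz0
  have neg_ne_one : -z ≠ 1 := fun h => by simp [← norm_neg z, h] at hz
  have add_one_ne_neg (m : ℕ) : z + 1 ≠ -m := fun h => by
    rw [show z = -((m + 1 : ℕ) : ℂ) by push_cast; linear_combination h, norm_neg,
      Complex.norm_natCast] at hz
    norm_cast at hz
  rw [riemannZeta₁_eq_sub_mul add_one_ne_one, riemannZeta₁_eq_sub_mul neg_ne_one,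
    show -z = 1 - (z + 1) by ring, riemannZeta_one_sub add_one_ne_neg add_one_ne_one,
    show (Real.pi : ℂ) * (z + 1) / 2 = Real.pi / 2 * z + Real.pi / 2 by ring,
    Complex.cos_add_pi_div_two, ← mul_entireSinc (Real.pi / 2 * z), sub_add_cancel_right, neg_add,
    Complex.cpow_add _ _ (by simp [hpi]), Complex.cpow_neg_one]
  field_simp
  ring

-- Compare second derivatives at `z = 0` in the functional equation `riemannZeta₁_neg`.
theorem deriv_deriv_riemannZeta₁_zero :
    deriv (deriv riemannZeta₁) 0 = -Real.log (2 * Real.pi)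
      + (Real.log (2 * Real.pi) ^ 2 - Real.eulerMascheroniConstant ^ 2 + Real.pi ^ 2 / 12
      + deriv (deriv riemannZeta₁) 1) / 2 := by
  have two_pi_ne_zero : (2 * Real.pi : ℂ) ≠ 0 := by simp [Real.pi_ne_zero]
  have log_two_pi : Complex.log (2 * Real.pi) = Real.log (2 * Real.pi) := by
    rw [Complex.ofReal_log (by positivity)]
    push_cast
    rfl
  have jet_zero := HasSecondJetAt.of_analyticAt (differentiable_riemannZeta₁.analyticAt 0)
  have jet_one := HasSecondJetAt.of_analyticAt (differentiable_riemannZeta₁.analyticAt 1)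
  rw [riemannZeta₁_one, deriv_riemannZeta₁_one] at jet_one
  have jet_right := (((((HasSecondJetAt.sub_const (-1 : ℂ) 0).mul
    (hasSecondJetAt_const_cpow_neg two_pi_ne_zero 0)).mul
    (hasSecondJetAt_Gamma_one.comp_affine (p := 1) (q := 1) (z := 0) (by simp))).mul
    (hasSecondJetAt_entireSinc_zero.comp_affine (p := (Real.pi / 2 : ℂ)) (q := 0) (z := 0)
      (by simp))).mul
    ((jet_one.comp_affine (p := 1) (q := 1) (z := 0) (by simp)).const_mul (1 / 2)))
  have norm_lt_one : ∀ᶠ z : ℂ in 𝓝 0, ‖z‖ < 1 := by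
    simpa using eventually_norm_sub_lt (0 : ℂ) one_pos
  have jet_right_eq := jet_right.congr (g := fun z => riemannZeta₁ (-1 * z + 0)) <|
    norm_lt_one.mono fun z hz => by
      simpa only [neg_one_mul, one_mul, add_zero, sub_neg_eq_add] using (riemannZeta₁_neg hz).symm
  have jet_left := jet_zero.comp_affine (p := -1) (q := 0) (z := 0) (by simp)
  have h := jet_left.deriv_deriv_eq.symm.trans jet_right_eq.deriv_deriv_eq
  rw [log_two_pi, neg_zero, Complex.cpow_zero] at h
  linear_combination h

lemma norm_trapezoid_error_le {E : Type*} [NormedAddCommGroup E] [NormedSpace ℝ E]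
    {F φ φ' φ'' : ℝ → E} {B : ℝ}
    (hF : ∀ t ∈ Set.Icc (0 : ℝ) 1, HasDerivAt F (φ t) t)
    (hφ : ∀ t ∈ Set.Icc (0 : ℝ) 1, HasDerivAt φ (φ' t) t)
    (hφ' : ∀ t ∈ Set.Icc (0 : ℝ) 1, HasDerivAt φ' (φ'' t) t)
    (hB : ∀ t ∈ Set.Icc (0 : ℝ) 1, ‖φ'' t‖ ≤ B) :
    ‖F 1 - F 0 - (2⁻¹ : ℝ) • (φ 0 + φ 1)‖ ≤ B / 2 := by
  have norm_tangent_error_le : ∀ t ∈ Set.Icc (0 : ℝ) 1, ‖φ t - φ 0 - t • φ' t‖ ≤ B := by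
    intro t ht
    have hasDerivAt_tangent_error : ∀ r ∈ Set.Icc (0 : ℝ) 1,
        HasDerivWithinAt (fun r => φ r - φ 0 - r • φ' r) (-(r • φ'' r)) (Set.Icc 0 1) r :=
      fun r hr => ((((hφ r hr).sub_const (φ 0)).fun_sub
        ((hasDerivAt_id r).fun_smul (hφ' r hr))).congr_deriv (by simp)).hasDerivWithinAt
    have norm_deriv_le : ∀ r ∈ Set.Ico (0 : ℝ) 1, ‖-(r • φ'' r)‖ ≤ B := fun r hr => by
      rw [norm_neg, norm_smul, Real.norm_of_nonneg hr.1]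
      exact (mul_le_of_le_one_left (norm_nonneg _) hr.2.le).trans (hB r ⟨hr.1, hr.2.le⟩)
    have h := norm_image_sub_le_of_norm_deriv_le_segment' hasDerivAt_tangent_error
      norm_deriv_le t ht
    simp only [sub_self, zero_smul, sub_zero] at h
    exact h.trans (mul_le_of_le_one_right ((norm_nonneg _).trans (hB t ht)) ht.2)
  have hasDerivAt_trapezoid_error : ∀ t ∈ Set.Icc (0 : ℝ) 1,
      HasDerivWithinAt (fun t => F t - (t / 2) • (φ 0 + φ t))
        ((2⁻¹ : ℝ) • (φ t - φ 0 - t • φ' t)) (Set.Icc 0 1) t := fun t ht =>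
    (((hF t ht).fun_sub (((hasDerivAt_id t).div_const 2).fun_smul
      ((hφ t ht).const_add (φ 0)))).congr_deriv (by simp only [id]; module)).hasDerivWithinAt
  have h := norm_image_sub_le_of_norm_deriv_le_segment_01' hasDerivAt_trapezoid_error
    (C := B / 2) fun t ht => by
      rw [norm_smul, Real.norm_of_nonneg (by norm_num), inv_mul_eq_div]
      gcongr
      exact norm_tangent_error_le t ⟨ht.1, ht.2.le⟩
  refine (congrArg norm ?_).trans_le h
  module

lemma hasDerivAt_add_ofReal_cpow {x t : ℝ} (hxt : 0 < x + t) (c : ℂ) :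
    HasDerivAt (fun t : ℝ => ((x : ℂ) + t) ^ c) (c * ((x : ℂ) + t) ^ (c - 1)) t := by
  have hasDerivAt_add : HasDerivAt (fun z : ℂ => (x : ℂ) + z) 1 (t : ℂ) :=
    (hasDerivAt_id _).const_add _
  simpa using (hasDerivAt_add.cpow_const (c := c) (Or.inl (by simpa using hxt))).comp_ofReal

lemma norm_trapezoid_cpow_error_le {x : ℝ} (hx : 0 < x) {s : ℂ} (hs : -2 ≤ s.re) :
    ‖((x : ℂ) + 1) ^ (1 - s) - (x : ℂ) ^ (1 - s)
      - (1 - s) / 2 * ((x : ℂ) ^ (-s) + ((x : ℂ) + 1) ^ (-s))‖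
      ≤ ‖(1 - s) * s * (s + 1)‖ / 2 * x ^ (-s.re - 2) := by
  have add_pos_of_mem {t : ℝ} (ht : t ∈ Set.Icc (0 : ℝ) 1) : 0 < x + t := by linarith [ht.1]
  have norm_second_deriv_le : ∀ t ∈ Set.Icc (0 : ℝ) 1,
      ‖(1 - s) * s * (s + 1) * ((x : ℂ) + t) ^ (-s - 2)‖
        ≤ ‖(1 - s) * s * (s + 1)‖ * x ^ (-s.re - 2) := fun t ht => by
    rw [norm_mul, ← Complex.ofReal_add, Complex.norm_cpow_eq_rpow_re_of_pos (add_pos_of_mem ht),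
      show (-s - 2).re = -s.re - 2 by simp]
    gcongr ?_ * ?_
    exact Real.rpow_le_rpow_of_nonpos hx (by linarith [ht.1]) (by linarith)
  have h := norm_trapezoid_error_le
    (F := fun t : ℝ => ((x : ℂ) + t) ^ (1 - s))
    (φ := fun t : ℝ => (1 - s) * ((x : ℂ) + t) ^ (-s))
    (φ' := fun t : ℝ => -((1 - s) * s) * ((x : ℂ) + t) ^ (-s - 1))
    (fun t ht => (hasDerivAt_add_ofReal_cpow (add_pos_of_mem ht) (1 - s)).congr_deriv (by ring_nf))
    (fun t ht => ((hasDerivAt_add_ofReal_cpow (add_pos_of_mem ht) (-s)).const_mul _).congr_deriv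
      (by ring))
    (fun t ht => ((hasDerivAt_add_ofReal_cpow (add_pos_of_mem ht) (-s - 1)).const_mul _).congr_deriv
      (by ring_nf))
    norm_second_deriv_le
  rw [mul_div_right_comm] at h
  refine (congrArg norm ?_).trans_le h
  rw [Complex.real_smul]
  push_cast
  ring_nf

/-- The Euler–Maclaurin approximation to `(s - 1) ζ(s)` from the first `M` terms of the series. It
keeps only the trapezoidal correction, which suffices in the half-plane `-1 < re s`. -/
noncomputable def zetaApprox (M : ℕ) (s : ℂ) : ℂ :=
  (s - 1) * (∑ k ∈ Finset.Icc 1 M, (k : ℂ) ^ (-s) - (M : ℂ) ^ (-s) / 2) + (M : ℂ) ^ (1 - s)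

lemma norm_zetaApprox_succ_sub_le {M : ℕ} (hM : M ≠ 0) {s : ℂ} (hs : -2 ≤ s.re) :
    ‖zetaApprox (M + 1) s - zetaApprox M s‖
      ≤ ‖(1 - s) * s * (s + 1)‖ / 2 * (M : ℝ) ^ (-s.re - 2) := by
  refine (congrArg norm ?_).trans_le
    (norm_trapezoid_cpow_error_le (x := M) (by positivity) hs)
  rw [zetaApprox, zetaApprox, Finset.sum_Icc_succ_top (by omega)]
  push_cast
  ring

lemma hasSecondJetAt_zetaApprox {M : ℕ} (hM : M ≠ 0) (s : ℂ) :
    HasSecondJetAt (zetaApprox M) (zetaApprox M s)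
      (∑ k ∈ Finset.Icc 1 M, (k : ℂ) ^ (-s) - (M : ℂ) ^ (-s) / 2
        - (s - 1) * (∑ k ∈ Finset.Icc 1 M, (k : ℂ) ^ (-s) * Complex.log k
          - (M : ℂ) ^ (-s) * Complex.log M / 2) - (M : ℂ) ^ (1 - s) * Complex.log M)
      (-2 * (∑ k ∈ Finset.Icc 1 M, (k : ℂ) ^ (-s) * Complex.log k
          - (M : ℂ) ^ (-s) * Complex.log M / 2)
        + (s - 1) * (∑ k ∈ Finset.Icc 1 M, (k : ℂ) ^ (-s) * Complex.log k ^ 2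
          - (M : ℂ) ^ (-s) * Complex.log M ^ 2 / 2)
        + (M : ℂ) ^ (1 - s) * Complex.log M ^ 2) s := by
  have hM' : (M : ℂ) ≠ 0 := Nat.cast_ne_zero.2 hM
  have jet_sum := HasSecondJetAt.sum (s := Finset.Icc 1 M) fun k hk =>
    hasSecondJetAt_const_cpow_neg (a := (k : ℂ))
      (Nat.cast_ne_zero.2 (Nat.one_le_iff_ne_zero.1 (Finset.mem_Icc.1 hk).1)) s
  have jet := ((HasSecondJetAt.sub_const 1 s).mul
    (jet_sum.add ((hasSecondJetAt_const_cpow_neg hM' s).const_mul (-1 / 2)))).add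
    (hasSecondJetAt_const_cpow_sub hM' 1 s)
  have jet_zetaApprox := jet.congr (g := zetaApprox M) (.of_forall fun z => by
    rw [zetaApprox]
    ring)
  refine ⟨jet_zetaApprox.analyticAt, rfl, jet_zetaApprox.deriv_eq.trans ?_,
    jet_zetaApprox.deriv_deriv_eq.trans ?_⟩
  all_goals
    rw [Finset.sum_neg_distrib]
    ring

lemma differentiable_zetaApprox {M : ℕ} (hM : M ≠ 0) : Differentiable ℂ (zetaApprox M) :=
  fun s => (hasSecondJetAt_zetaApprox hM s).analyticAt.differentiableAt

lemma tendsto_natCast_cpow_atTop_zero {c : ℂ} (hc : c.re < 0) :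
    Tendsto (fun M : ℕ => (M : ℂ) ^ c) atTop (𝓝 0) := by
  rw [tendsto_zero_iff_norm_tendsto_zero]
  have tendsto_rpow := (tendsto_rpow_neg_atTop (neg_pos.2 hc)).comp tendsto_natCast_atTop_atTop
  refine tendsto_rpow.congr' ?_
  filter_upwards [eventually_gt_atTop 0] with M hM
  simp [Complex.norm_natCast_cpow_of_pos hM]

lemma tendsto_zetaApprox_of_one_lt_re {s : ℂ} (hs : 1 < s.re) :
    Tendsto (fun M => zetaApprox M s) atTop (𝓝 (riemannZeta₁ s)) := by
  have ne_one : s ≠ 1 := by rintro rfl; simp at hs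
  have ne_zero : s ≠ 0 := by rintro rfl; norm_num at hs
  have tendsto_sum : Tendsto (fun M : ℕ => ∑ k ∈ Finset.Icc 1 M, (k : ℂ) ^ (-s)) atTop
      (𝓝 (riemannZeta s)) := by
    have h := (Complex.summable_one_div_nat_cpow.2 hs).hasSum.tendsto_sum_nat
    rw [← zeta_eq_tsum_one_div_nat_cpow hs] at h
    refine (h.comp (tendsto_add_atTop_nat 1)).congr fun M => ?_
    simp only [Function.comp_apply, one_div, ← Complex.cpow_neg]
    rw [Finset.range_eq_Ico, Finset.sum_eq_sum_Ico_succ_bot (by omega), Nat.cast_zero,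
      Complex.zero_cpow (neg_ne_zero.2 ne_zero), zero_add]
    rfl
  have tendsto_cpow_neg := tendsto_natCast_cpow_atTop_zero (c := -s) (by simp; linarith)
  have tendsto_cpow_one_sub := tendsto_natCast_cpow_atTop_zero (c := 1 - s) (by simpa using hs)
  have h := ((tendsto_sum.sub (tendsto_cpow_neg.div_const 2)).const_mul (s - 1)).add
    tendsto_cpow_one_sub
  rwa [zero_div, sub_zero, add_zero, ← riemannZeta₁_eq_sub_mul ne_one] at h

lemma exists_summable_norm_zetaApprox_sub_le {K : Set ℂ} (hK : IsCompact K)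
    (hre : ∀ s ∈ K, -1 < s.re) :
    ∃ u : ℕ → ℝ, Summable u ∧
      ∀ n, ∀ s ∈ K, ‖zetaApprox (n + 1 + 1) s - zetaApprox (n + 1) s‖ ≤ u n := by
  rcases K.eq_empty_or_nonempty with rfl | hne
  · exact ⟨0, summable_zero, by simp⟩
  obtain ⟨c, hc⟩ := hK.exists_bound_of_continuousOn
    (f := fun s : ℂ => (1 - s) * s * (s + 1)) (by fun_prop)
  obtain ⟨s₀, hs₀, re_min⟩ := hK.exists_isMinOn hne Complex.continuous_re.continuousOn
  refine ⟨fun n => c / 2 * ((n + 1 : ℕ) : ℝ) ^ (-s₀.re - 2),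
    ((summable_nat_add_iff 1).2 (Real.summable_nat_rpow.2 ?_)).mul_left _, fun n s hs => ?_⟩
  · linarith [hre s₀ hs₀]
  · have hs_re : s₀.re ≤ s.re := re_min hs
    refine (norm_zetaApprox_succ_sub_le n.succ_ne_zero (by linarith [hre s hs])).trans ?_
    exact mul_le_mul (div_le_div_of_nonneg_right (hc s hs) two_pos.le)
      (Real.rpow_le_rpow_of_exponent_le (by simp) (by linarith)) (by positivity)
      (div_nonneg ((norm_nonneg _).trans (hc s hs)) two_pos.le)

lemma isOpen_neg_one_lt_re : IsOpen {s : ℂ | -1 < s.re} :=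
  isOpen_lt continuous_const Complex.continuous_re

lemma tendstoLocallyUniformlyOn_zetaApprox_tsum :
    TendstoLocallyUniformlyOn (fun M => zetaApprox (M + 1))
      (fun s => zetaApprox 1 s + ∑' n, (zetaApprox (n + 1 + 1) s - zetaApprox (n + 1) s))
      atTop {s | -1 < s.re} := by
  rw [tendstoLocallyUniformlyOn_iff_forall_isCompact isOpen_neg_one_lt_re]
  intro K hK hK_compact
  obtain ⟨u, hu, norm_le⟩ := exists_summable_norm_zetaApprox_sub_le hK_compact fun s hs => hK hs
  have tendsto_partial_sums := tendstoUniformlyOn_tsum_nat hu norm_le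
  rw [Metric.tendstoUniformlyOn_iff] at tendsto_partial_sums ⊢
  intro ε hε
  filter_upwards [tendsto_partial_sums ε hε] with M hM s hs
  have h := hM s hs
  rwa [Finset.sum_range_sub (fun n => zetaApprox (n + 1) s), ← dist_add_left (zetaApprox 1 s),
    add_sub_cancel] at h

theorem tendstoLocallyUniformlyOn_zetaApprox :
    TendstoLocallyUniformlyOn (fun M => zetaApprox (M + 1)) riemannZeta₁ atTop
      {s | -1 < s.re} := by
  have tendsto_limit := tendstoLocallyUniformlyOn_zetaApprox_tsum
  have analytic_limit := (tendsto_limit.differentiableOn (.of_forall fun M =>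
    (differentiable_zetaApprox M.succ_ne_zero).differentiableOn)
    isOpen_neg_one_lt_re).analyticOnNhd isOpen_neg_one_lt_re
  refine tendsto_limit.congr_right <| analytic_limit.eqOn_of_preconnected_of_eventuallyEq
    (fun s _ => differentiable_riemannZeta₁.analyticAt s)
    (convex_halfSpace_re_gt _).isPreconnected (z₀ := 2) (by norm_num) ?_
  have one_lt_re : ∀ᶠ s : ℂ in 𝓝 2, 1 < s.re :=
    Complex.continuous_re.continuousAt.eventually (lt_mem_nhds (by simp))
  filter_upwards [one_lt_re] with s hs
  exact tendsto_nhds_unique (tendsto_limit.tendsto_at (show -1 < s.re by linarith))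
    ((tendsto_zetaApprox_of_one_lt_re hs).comp (tendsto_add_atTop_nat 1))

lemma tendsto_deriv_deriv_zetaApprox {s : ℂ} (hs : -1 < s.re) :
    Tendsto (fun M => deriv (deriv (zetaApprox (M + 1))) s) atTop
      (𝓝 (deriv (deriv riemannZeta₁) s)) := by
  have differentiable_approx (M : ℕ) : Differentiable ℂ (zetaApprox (M + 1)) :=
    differentiable_zetaApprox M.succ_ne_zero
  have tendsto_deriv := tendstoLocallyUniformlyOn_zetaApprox.deriv
    (.of_forall fun M => (differentiable_approx M).differentiableOn) isOpen_neg_one_lt_re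
  exact (tendsto_deriv.deriv (.of_forall fun M => (differentiable_approx M).deriv.differentiableOn)
    isOpen_neg_one_lt_re).tendsto_at hs

lemma deriv_deriv_zetaApprox_one {M : ℕ} (hM : M ≠ 0) :
    deriv (deriv (zetaApprox M)) 1 = ((-2 * stieltjesSeqOne M + Real.log M / M : ℝ) : ℂ) := by
  rw [(hasSecondJetAt_zetaApprox hM 1).deriv_deriv_eq, stieltjesSeqOne]
  push_cast
  simp only [Complex.cpow_neg_one, sub_self, Complex.cpow_zero,
    inv_mul_eq_div]
  ring

lemma deriv_deriv_zetaApprox_zero {M : ℕ} (hM : M ≠ 0) :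
    deriv (deriv (zetaApprox M)) 0
      = ((-2 * ∑ k ∈ Finset.Icc 1 M, Real.log k + Real.log M
        - (∑ k ∈ Finset.Icc 1 M, Real.log k ^ 2 - Real.log M ^ 2 / 2)
        + M * Real.log M ^ 2 : ℝ) : ℂ) := by
  rw [(hasSecondJetAt_zetaApprox hM 0).deriv_deriv_eq]
  push_cast
  simp only [neg_zero, Complex.cpow_zero, one_mul, sub_zero,
    Complex.cpow_one]
  ring

theorem deriv_deriv_riemannZeta₁_one :
    deriv (deriv riemannZeta₁) 1 = ((-2 * stieltjesGammaOne : ℝ) : ℂ) := by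
  have tendsto_log_div : Tendsto (fun M : ℕ => Real.log M / M) atTop (𝓝 0) :=
    Real.isLittleO_log_id_atTop.tendsto_div_nhds_zero.comp tendsto_natCast_atTop_atTop
  have tendsto_approx := (tendsto_stieltjesSeqOne.const_mul (-2)).add tendsto_log_div
  rw [add_zero] at tendsto_approx
  refine tendsto_nhds_unique (tendsto_deriv_deriv_zetaApprox (by norm_num)) ?_
  refine ((Complex.continuous_ofReal.tendsto _).comp
    (tendsto_approx.comp (tendsto_add_atTop_nat 1))).congr fun M => ?_
  exact (deriv_deriv_zetaApprox_one M.succ_ne_zero).symm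

lemma tendsto_sum_log_sub :
    Tendsto (fun M : ℕ => ∑ k ∈ Finset.Icc 1 M, Real.log k
      - (M * Real.log M - M + Real.log M / 2)) atTop (𝓝 (Real.log (2 * Real.pi) / 2)) := by
  have h := (Stirling.tendsto_stirlingSeq_sqrt_pi.log (by positivity)).const_add (Real.log 2 / 2)
  rw [Real.log_sqrt Real.pi_pos.le, ← add_div,
    ← Real.log_mul two_ne_zero Real.pi_ne_zero] at h
  refine h.congr' ?_
  filter_upwards [eventually_ne_atTop 0] with M hM
  have sum_log : ∑ k ∈ Finset.Icc 1 M, Real.log k = Real.log (M.factorial) := by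
    rw [← Finset.prod_Ico_id_eq_factorial, Nat.cast_prod, Real.log_prod fun k hk =>
      Nat.cast_ne_zero.2 (Nat.one_le_iff_ne_zero.1 (Finset.mem_Ico.1 hk).1)]
    rfl
  have hM' : (M : ℝ) ≠ 0 := Nat.cast_ne_zero.2 hM
  rw [sum_log, Stirling.log_stirlingSeq_formula, Real.log_mul two_ne_zero hM',
    Real.log_div hM' (Real.exp_ne_zero 1), Real.log_exp]
  ring

theorem tendsto_sum_log_sq_sub :
    Tendsto (fun M : ℕ => ∑ k ∈ Finset.Icc 1 M, Real.log k ^ 2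
      - (M * Real.log M ^ 2 - 2 * M * Real.log M + 2 * M + 1 / 2 * Real.log M ^ 2)) atTop
      (𝓝 (Real.eulerMascheroniConstant ^ 2 / 2 - Real.pi ^ 2 / 24 - Real.log 2 ^ 2 / 2
        - Real.log 2 * Real.log Real.pi - Real.log Real.pi ^ 2 / 2 + stieltjesGammaOne)) := by
  have tendsto_re := (Complex.continuous_re.tendsto _).comp
    (tendsto_deriv_deriv_zetaApprox (s := 0) (by simp))
  have tendsto_approx : Tendsto (fun M : ℕ => -2 * ∑ k ∈ Finset.Icc 1 M, Real.log k + Real.log M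
      - (∑ k ∈ Finset.Icc 1 M, Real.log k ^ 2 - Real.log M ^ 2 / 2) + M * Real.log M ^ 2)
      atTop (𝓝 (deriv (deriv riemannZeta₁) 0).re) := by
    rw [← tendsto_add_atTop_iff_nat 1]
    refine tendsto_re.congr fun M => ?_
    rw [Function.comp_apply, deriv_deriv_zetaApprox_zero M.succ_ne_zero, Complex.ofReal_re]
  have deriv_deriv_re : (deriv (deriv riemannZeta₁) 0).re = -Real.log (2 * Real.pi)
      + (Real.log (2 * Real.pi) ^ 2 - Real.eulerMascheroniConstant ^ 2 + Real.pi ^ 2 / 12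
        - 2 * stieltjesGammaOne) / 2 := by
    rw [deriv_deriv_riemannZeta₁_zero, deriv_deriv_riemannZeta₁_one, ← Complex.ofReal_re (_ + _)]
    congr 1
    push_cast
    ring
  have h := (tendsto_approx.add (tendsto_sum_log_sub.const_mul 2)).neg
  rw [deriv_deriv_re, Real.log_mul two_ne_zero Real.pi_ne_zero] at h
  convert h using 2
  · ring
  · ring

section PolynomialOperators

open Polynomial hiding bernoulli sum_bernoulli

/-- The linear functional on polynomials with `X ^ l ↦ c l`. -/
noncomputable def momentFunctional {R : Type*} [CommSemiring R] (c : ℕ → R) : R[X] →ₗ[R] R :=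
  lsum fun l => c l • LinearMap.id

section CommSemiring

variable {R : Type*} [CommSemiring R] (c : ℕ → R)

lemma momentFunctional_monomial (l : ℕ) (a : R) :
    momentFunctional c (monomial l a) = c l * a := by
  simp [momentFunctional, lsum_apply, sum_monomial_index]

lemma momentFunctional_eq_sum {p : R[X]} {n : ℕ} (h : p.natDegree < n) :
    momentFunctional c p = ∑ l ∈ Finset.range n, c l * p.coeff l := by
  conv_lhs => rw [p.as_sum_range' n h]
  simp only [map_sum, momentFunctional_monomial]

end CommSemiring

/-- The backward difference `p(X) - p(X - 1)` of a polynomial. -/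
noncomputable def backwardDiff {R : Type*} [CommRing R] : R[X] →ₗ[R] R[X] :=
  LinearMap.id - (aeval (X - 1)).toLinearMap

section CommRing

variable {R : Type*} [CommRing R]

lemma backwardDiff_apply (p : R[X]) : backwardDiff p = p - p.comp (X - 1) := rfl

lemma eq_of_backwardDiff_eq [IsDomain R] [CharZero R] {p q : R[X]}
    (h : backwardDiff p = backwardDiff q) (h_zero : p.eval 0 = q.eval 0) : p = q := by
  have eval_natCast_eq : ∀ n : ℕ, p.eval (n : R) = q.eval (n : R) := by
    intro n
    induction n with
    | zero => simpa using h_zero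
    | succ n ih =>
      have eval_eq := congrArg (eval ((n : R) + 1)) h
      simp only [backwardDiff_apply, eval_sub, eval_comp, eval_X, eval_one,
        add_sub_cancel_right] at eval_eq
      rw [ih] at eval_eq
      exact_mod_cast sub_left_inj.1 eval_eq
  exact eq_of_infinite_eval_eq _ _
    (Set.infinite_of_injective_forall_mem Nat.cast_injective eval_natCast_eq)

lemma derivative_backwardDiff (p : R[X]) :
    derivative (backwardDiff p) = backwardDiff (derivative p) := by
  simp [backwardDiff_apply, derivative_comp]

lemma backwardDiff_X_pow (l : ℕ) :
    backwardDiff (X ^ l : R[X])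
      = -∑ j ∈ Finset.range l, monomial j ((l.choose j : R) * (-1) ^ (l - j)) := by
  rw [backwardDiff_apply, pow_comp, X_comp, sub_eq_add_neg X, add_pow, Finset.sum_range_succ]
  simp only [Nat.sub_self, pow_zero, mul_one, Nat.choose_self, Nat.cast_one, sub_add_cancel_right]
  congr 1
  refine Finset.sum_congr rfl fun j _ => ?_
  rw [← C_mul_X_pow_eq_monomial]
  simp only [map_mul, map_natCast, map_pow, map_neg, map_one]
  ring

lemma backwardDiff_ascPochhammer_zero : backwardDiff (ascPochhammer R 0) = 0 := by
  simp [backwardDiff_apply]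

lemma backwardDiff_ascPochhammer_succ (k : ℕ) :
    backwardDiff (ascPochhammer R (k + 1)) = ((k : R) + 1) • ascPochhammer R k := by
  have comp_eq : (ascPochhammer R (k + 1)).comp (X - 1) = (X - 1) * ascPochhammer R k := by
    rw [ascPochhammer_succ_left, mul_comp, comp_assoc]
    simp
  rw [backwardDiff_apply, comp_eq, ascPochhammer_succ_right, smul_eq_C_mul, C_add, C_1,
    C_eq_natCast]
  ring

lemma backwardDiff_sum_ascPochhammer (c : ℕ → R) (n : ℕ) :
    backwardDiff (∑ k ∈ Finset.range (n + 1), c k • ascPochhammer R k)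
      = ∑ k ∈ Finset.range n, (c (k + 1) * ((k : R) + 1)) • ascPochhammer R k := by
  simp only [Finset.sum_range_succ' _ n, map_add, map_sum, map_smul,
    backwardDiff_ascPochhammer_zero, backwardDiff_ascPochhammer_succ, smul_zero, add_zero, mul_smul]

lemma eval_zero_sum_ascPochhammer (c : ℕ → R) (n : ℕ) :
    (∑ k ∈ Finset.range (n + 1), c k • ascPochhammer R k).eval 0 = c 0 := by
  simp [Finset.sum_range_succ', eval_finsetSum]

lemma X_add_natCast_mul_sum_ascPochhammer {c : ℕ → R} {m : ℕ} (hc_zero : c 0 = 0)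
    (hc_succ : c (m + 1) = 0) :
    (X + (m : R[X])) * ∑ k ∈ Finset.range (m + 1), c k • ascPochhammer R k
      = ∑ k ∈ Finset.range (m + 1),
        (c k + ((m : R) - (k + 1)) * c (k + 1)) • ascPochhammer R (k + 1) := by
  have mul_ascPochhammer : ∀ k : ℕ, (X + (m : R[X])) * c k • ascPochhammer R k
      = c k • ascPochhammer R (k + 1) + (((m : R) - k) * c k) • ascPochhammer R k := by
    intro k
    rw [ascPochhammer_succ_right]
    simp only [smul_eq_C_mul, C_mul, C_sub, C_eq_natCast]
    ring
  have sum_shift : ∑ k ∈ Finset.range (m + 1), (((m : R) - k) * c k) • ascPochhammer R k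
      = ∑ k ∈ Finset.range (m + 1),
        (((m : R) - (k + 1)) * c (k + 1)) • ascPochhammer R (k + 1) := by
    rw [Finset.sum_range_succ', Finset.sum_range_succ _ m, hc_zero, hc_succ]
    simp
  simp only [Finset.mul_sum, mul_ascPochhammer, Finset.sum_add_distrib, sum_shift, add_smul]

end CommRing

/-- The antiderivative of a polynomial which vanishes at `0`. -/
noncomputable def antiderivative {F : Type*} [Field F] : F[X] →ₗ[F] F[X] :=
  lsum fun l => (1 / ((l : F) + 1)) • monomial (l + 1)

/-- The operator `X ^ l ↦ -H_l X ^ l`, where `H_l` is the harmonic number. -/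
noncomputable def harmonicOperator {F : Type*} [Field F] : F[X] →ₗ[F] F[X] :=
  lsum fun l => (-(harmonic l : F)) • monomial l

section Field

variable {F : Type*} [Field F]

lemma antiderivative_monomial (l : ℕ) (a : F) :
    antiderivative (monomial l a) = monomial (l + 1) (1 / ((l : F) + 1) * a) := by
  simp [antiderivative, lsum_apply, sum_monomial_index, smul_monomial]

lemma harmonicOperator_monomial (l : ℕ) (a : F) :
    harmonicOperator (monomial l a) = monomial l (-(harmonic l : F) * a) := by
  simp [harmonicOperator, lsum_apply, sum_monomial_index, smul_monomial]

lemma antiderivative_eval_zero (p : F[X]) : (antiderivative p).eval 0 = 0 := by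
  induction p using Polynomial.induction_on' with
  | add p q hp hq => rw [map_add, eval_add, hp, hq, add_zero]
  | monomial l a => simp [antiderivative_monomial]

lemma momentFunctional_harmonicOperator (c : ℕ → F) (p : F[X]) :
    momentFunctional c (harmonicOperator p)
      = momentFunctional (fun l => -(harmonic l : F) * c l) p := by
  induction p using Polynomial.induction_on' with
  | add p q hp hq => simp only [map_add, hp, hq]
  | monomial l a =>
    rw [harmonicOperator_monomial, momentFunctional_monomial, momentFunctional_monomial]
    ring

variable [CharZero F]

lemma derivative_antiderivative (p : F[X]) : derivative (antiderivative p) = p := by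
  induction p using Polynomial.induction_on' with
  | add p q hp hq => rw [map_add, map_add, hp, hq]
  | monomial l a =>
    have : (l : F) + 1 ≠ 0 := Nat.cast_add_one_ne_zero l
    rw [antiderivative_monomial, derivative_monomial]
    congr 1
    push_cast
    field_simp

lemma eq_of_derivative_eq {p q : F[X]} (h : derivative p = derivative q)
    (h_zero : p.eval 0 = q.eval 0) : p = q := by
  have derivative_sub_eq : derivative (p - q) = 0 := by rw [derivative_sub, h, sub_self]
  obtain ⟨c, hc⟩ := natDegree_eq_zero.1 (derivative_eq_zero.1 derivative_sub_eq)
  have c_eq_zero : c = 0 := by simpa [h_zero] using congrArg (eval 0) hc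
  rw [c_eq_zero, C_0] at hc
  exact sub_eq_zero.1 hc.symm

lemma backwardDiff_antiderivative (p : F[X]) :
    backwardDiff (antiderivative p)
      = antiderivative (backwardDiff p) - C ((antiderivative p).eval (-1)) := by
  refine eq_of_derivative_eq ?_ ?_
  · simp [derivative_backwardDiff, derivative_antiderivative]
  · simp [backwardDiff_apply, antiderivative_eval_zero, eval_comp]

lemma harmonicOperator_X_mul (p : F[X]) :
    harmonicOperator (X * p) = X * harmonicOperator p - antiderivative p := by
  induction p using Polynomial.induction_on' with
  | add p q hp hq => simp only [mul_add, map_add, hp, hq]; ring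
  | monomial l a =>
    rw [X_mul_monomial, harmonicOperator_monomial, harmonicOperator_monomial,
      antiderivative_monomial, X_mul_monomial, ← map_sub, harmonic_succ]
    congr 1
    push_cast
    ring

end Field

/-- The integral `∫_0^1 (-y)(1-y)⋯(j-1-y) dy`. -/
noncomputable def gregoryMoment (j : ℕ) : ℝ := -(antiderivative (ascPochhammer ℝ j)).eval (-1)

/-- The coefficient of `1 / (x)_{m+1}` in the factorial series of `(-Δ)^k log x / k!`. -/
noncomputable def logDiffCoeff : ℕ → ℕ → ℝ
  | 0, _ => 0
  | 1, m => -gregoryMoment m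
  | _ + 2, 0 => 0
  | k + 2, m + 1 => ((m : ℝ) + 1) / ((k : ℝ) + 2) * logDiffCoeff (k + 1) m

lemma gregoryMoment_zero : gregoryMoment 0 = 1 := by
  rw [gregoryMoment, ascPochhammer_zero, ← monomial_zero_one, antiderivative_monomial]
  simp

lemma logDiffCoeff_eq_zero {k m : ℕ} (h : m + 1 < k) : logDiffCoeff k m = 0 := by
  induction k generalizing m with
  | zero => omega
  | succ k ih =>
    match k, m with
    | 0, _ => omega
    | k + 1, 0 => rw [logDiffCoeff]
    | k + 1, m + 1 => rw [logDiffCoeff, ih (by omega), mul_zero]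

theorem antiderivative_ascPochhammer (m : ℕ) :
    antiderivative (ascPochhammer ℝ m)
      = ∑ k ∈ Finset.range (m + 2), (-logDiffCoeff k m) • ascPochhammer ℝ k := by
  induction m with
  | zero =>
    refine eq_of_derivative_eq ?_ ?_
    · rw [derivative_antiderivative]
      simp [Finset.sum_range_succ, logDiffCoeff, gregoryMoment_zero]
    · rw [antiderivative_eval_zero, eval_zero_sum_ascPochhammer, logDiffCoeff, neg_zero]
  | succ m ih =>
    refine eq_of_backwardDiff_eq ?_ ?_
    · rw [backwardDiff_antiderivative, backwardDiff_ascPochhammer_succ, map_smul, ih,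
        backwardDiff_sum_ascPochhammer, Finset.sum_range_succ' _ (m + 1),
        Finset.sum_range_succ' _ (m + 1), sub_eq_add_neg, ← C_neg, ← gregoryMoment,
        ascPochhammer_zero, ← mul_one (C _), ← smul_eq_C_mul]
      simp only [logDiffCoeff, Finset.smul_sum, smul_smul, Nat.cast_zero, zero_add, neg_neg,
        neg_zero, zero_smul, add_zero, mul_one]
      congr 1
      refine Finset.sum_congr rfl fun k _ => ?_
      congr 1
      push_cast
      field_simp
      ring
    · rw [antiderivative_eval_zero, eval_zero_sum_ascPochhammer, logDiffCoeff, neg_zero]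

/-- The matrix of `harmonicOperator` in the basis of the rising factorials: `harmonicMatrix m k` is
the coefficient of `(X)_k` in the image of `(X)_m`. -/
noncomputable def harmonicMatrix : ℕ → ℕ → ℝ
  | 0, _ => 0
  | _ + 1, 0 => 0
  | m + 1, k + 1 => harmonicMatrix m k + ((m : ℝ) - (k + 1)) * harmonicMatrix m (k + 1)
      + logDiffCoeff (k + 1) m

lemma harmonicMatrix_zero_right (m : ℕ) : harmonicMatrix m 0 = 0 := by
  cases m <;> rw [harmonicMatrix]

lemma harmonicMatrix_eq_zero {m k : ℕ} (h : m < k) : harmonicMatrix m k = 0 := by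
  induction m generalizing k with
  | zero => rw [harmonicMatrix]
  | succ m ih =>
    match k with
    | 0 => omega
    | k + 1 =>
      rw [harmonicMatrix, ih (by omega), ih (by omega), logDiffCoeff_eq_zero (by omega)]
      ring

theorem harmonicOperator_ascPochhammer (m : ℕ) :
    harmonicOperator (ascPochhammer ℝ m)
      = ∑ k ∈ Finset.range (m + 1), harmonicMatrix m k • ascPochhammer ℝ k := by
  induction m with
  | zero =>
    rw [ascPochhammer_zero, ← monomial_zero_one, harmonicOperator_monomial]
    simp [harmonicMatrix]
  | succ m ih =>
    have ascPochhammer_succ :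
        ascPochhammer ℝ (m + 1) = X * ascPochhammer ℝ m + (m : ℝ) • ascPochhammer ℝ m := by
      rw [ascPochhammer_succ_right, smul_eq_C_mul, C_eq_natCast]
      ring
    calc harmonicOperator (ascPochhammer ℝ (m + 1))
        = (X + (m : ℝ[X])) * harmonicOperator (ascPochhammer ℝ m)
          - antiderivative (ascPochhammer ℝ m) := by
          rw [ascPochhammer_succ, map_add, map_smul, harmonicOperator_X_mul, smul_eq_C_mul,
            C_eq_natCast]
          ring
      _ = ∑ k ∈ Finset.range (m + 1), harmonicMatrix (m + 1) (k + 1)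
            • ascPochhammer ℝ (k + 1) := by
          rw [ih, X_add_natCast_mul_sum_ascPochhammer (harmonicMatrix_zero_right m)
            (harmonicMatrix_eq_zero m.lt_succ_self), antiderivative_ascPochhammer,
            Finset.sum_range_succ' _ (m + 1)]
          simp only [logDiffCoeff, neg_zero, zero_smul, add_zero, neg_smul, Finset.sum_neg_distrib,
            sub_neg_eq_add, ← Finset.sum_add_distrib, ← add_smul, harmonicMatrix]
      _ = ∑ k ∈ Finset.range (m + 2), harmonicMatrix (m + 1) k • ascPochhammer ℝ k := by
          rw [Finset.sum_range_succ' _ (m + 1), harmonicMatrix_zero_right, zero_smul, add_zero]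

lemma momentFunctional_harmonicOperator_ascPochhammer (c : ℕ → ℝ) (m : ℕ) :
    momentFunctional c (harmonicOperator (ascPochhammer ℝ m))
      = ∑ k ∈ Finset.range (m + 1), momentFunctional c (ascPochhammer ℝ k)
        * harmonicMatrix m k := by
  simp only [harmonicOperator_ascPochhammer, map_sum, map_smul, smul_eq_mul, mul_comm]

/-- The moments `B_{l+2} / ((l+1)(l+2))`, so that `momentFunctional bernoulliMoment` sends the
rising factorials to the coefficients `logCoeff`. -/
noncomputable def bernoulliMoment (l : ℕ) : ℝ :=
  ((bernoulli (l + 2) : ℚ) : ℝ) / (((l : ℝ) + 1) * ((l : ℝ) + 2))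

lemma neg_one_pow_mul_bernoulliMoment (l : ℕ) :
    (-1) ^ l * bernoulliMoment l = bernoulliMoment l := by
  rcases l.even_or_odd with h | h
  · rw [h.neg_one_pow, one_mul]
  · simp [bernoulliMoment, bernoulli_eq_zero_of_odd (h.add_even even_two) (by omega)]

lemma stirlingS_cast (k l : ℕ) :
    (stirlingS k l : ℝ) = (-1) ^ (k + l) * (ascPochhammer ℝ k).coeff l := by
  rw [stirlingS, ← ascPochhammer_map (Int.castRingHom ℝ), coeff_map]
  push_cast
  rfl

lemma momentFunctional_ascPochhammer (c : ℕ → ℝ) {k : ℕ} (hk : k ≠ 0) :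
    momentFunctional c (ascPochhammer ℝ k)
      = ∑ l ∈ Finset.Icc 1 k, c l * (ascPochhammer ℝ k).coeff l := by
  rw [momentFunctional_eq_sum c (n := k + 1) (by rw [ascPochhammer_natDegree]; omega),
    Finset.range_eq_Ico, Finset.sum_eq_sum_Ico_succ_bot (by omega), coeff_zero_eq_eval_zero,
    ascPochhammer_ne_zero_eval_zero ℝ hk, mul_zero, zero_add]
  rfl

theorem logCoeff_eq_momentFunctional {k : ℕ} (hk : k ≠ 0) :
    logCoeff k = momentFunctional bernoulliMoment (ascPochhammer ℝ k) := by
  rw [momentFunctional_ascPochhammer _ hk, logCoeff, Finset.mul_sum]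
  refine Finset.sum_congr rfl fun l _ => ?_
  have sign_sq : ((-1 : ℝ) ^ k) ^ 2 = 1 := by rw [← pow_mul, mul_comm, pow_mul]; norm_num
  rw [stirlingS_cast, ← neg_one_pow_mul_bernoulliMoment, bernoulliMoment, pow_add]
  linear_combination ((-1) ^ l * (ascPochhammer ℝ k).coeff l *
    ((bernoulli (l + 2) : ℝ) / (((l : ℝ) + 1) * ((l : ℝ) + 2)))) * sign_sq

lemma ascPochhammer_coeff_one (k : ℕ) : (ascPochhammer ℝ (k + 1)).coeff 1 = k.factorial := by
  rw [ascPochhammer_succ_left, coeff_X_mul, coeff_zero_eq_eval_zero, eval_comp]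
  simp [ascPochhammer_eval_one]

lemma ascPochhammer_coeff_two (k : ℕ) :
    (ascPochhammer ℝ (k + 1)).coeff 2 = k.factorial * harmonic k := by
  induction k with
  | zero => simp [coeff_X]
  | succ k ih =>
    rw [ascPochhammer_succ_right, mul_add, coeff_add, coeff_mul_X, ascPochhammer_coeff_one,
      ← C_eq_natCast, coeff_mul_C, ih, harmonic_succ, Nat.factorial_succ]
    push_cast
    field_simp
    ring

theorem plainCoeff_eq_momentFunctional {k : ℕ} (hk : k ≠ 0) :
    plainCoeff k = momentFunctional bernoulliMoment (harmonicOperator (ascPochhammer ℝ k)) := by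
  rw [momentFunctional_harmonicOperator, momentFunctional_ascPochhammer _ hk, plainCoeff,
    Finset.mul_sum]
  refine Finset.sum_congr rfl fun l _ => ?_
  have sign_sq : ∀ j : ℕ, ((-1 : ℝ) ^ j) ^ 2 = 1 := fun j => by
    rw [← pow_mul, mul_comm, pow_mul]; norm_num
  rw [stirlingS_cast, stirlingS_cast, ← neg_one_pow_mul_bernoulliMoment, bernoulliMoment,
    ascPochhammer_coeff_two, Nat.factorial_succ, Nat.factorial_succ, pow_add, pow_add]
  push_cast
  field_simp
  linear_combination -((ascPochhammer ℝ k).coeff l * (bernoulli (l + 2) : ℝ)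
    * harmonic l * ((l : ℝ) + 2)) * (((-1) ^ l) ^ 2 * sign_sq k + sign_sq l)

end PolynomialOperators

/-- The rising factorial `(x)_k = x (x+1) ⋯ (x+k-1)` as a function of a real variable. -/
noncomputable def rising (k : ℕ) (x : ℝ) : ℝ := (ascPochhammer ℝ k).eval x

section RisingFactorials

@[simp]
lemma rising_zero (x : ℝ) : rising 0 x = 1 := by simp [rising]

lemma rising_succ (k : ℕ) (x : ℝ) : rising (k + 1) x = rising k x * (x + k) :=
  ascPochhammer_succ_eval k x

lemma rising_succ_left (k : ℕ) (x : ℝ) : rising (k + 1) x = x * rising k (x + 1) := by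
  simp [rising, ascPochhammer_succ_left]

lemma rising_one (k : ℕ) : rising k 1 = k.factorial := ascPochhammer_eval_one ℝ k

lemma rising_two (k : ℕ) : rising k 2 = (k + 1).factorial := by
  rw [← rising_one, rising_succ_left, one_mul, one_add_one_eq_two]

lemma risingProd_eq_rising (n k : ℕ) : risingProd n k = rising (k + 1) n := by
  induction k with
  | zero => simp [risingProd, rising_succ]
  | succ k ih => rw [rising_succ, ← ih, risingProd, Finset.prod_range_succ, risingProd]

@[fun_prop]
lemma continuous_rising (k : ℕ) : Continuous (rising k) := (ascPochhammer ℝ k).continuous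

lemma rising_pos (k : ℕ) {x : ℝ} (hx : 0 < x) : 0 < rising k x := ascPochhammer_pos k x hx

lemma rising_nonneg (k : ℕ) {x : ℝ} (hx : 0 ≤ x) : 0 ≤ rising k x := by
  induction k with
  | zero => simp
  | succ k ih =>
    rw [rising_succ]
    positivity

lemma rising_mono (k : ℕ) {x y : ℝ} (hx : 0 ≤ x) (hxy : x ≤ y) : rising k x ≤ rising k y := by
  induction k with
  | zero => simp
  | succ k ih =>
    rw [rising_succ, rising_succ]
    exact mul_le_mul ih (by linarith) (by positivity) (rising_nonneg k (hx.trans hxy))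

lemma factorial_le_rising (k : ℕ) {x : ℝ} (hx : 1 ≤ x) : (k.factorial : ℝ) ≤ rising k x := by
  rw [← rising_one]
  exact rising_mono k zero_le_one hx

lemma factorial_succ_mul_le_rising (k : ℕ) {x : ℝ} (hx : 1 ≤ x) :
    ((k + 1).factorial : ℝ) * x ≤ rising (k + 1) x := by
  rw [rising_succ_left, ← rising_two, mul_comm]
  exact mul_le_mul_of_nonneg_left (rising_mono k zero_le_two (by linarith)) (by linarith)

lemma rising_one_sub_le_factorial (k : ℕ) {y : ℝ} (hy : y ∈ Set.Icc (0 : ℝ) 1) :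
    rising k (1 - y) ≤ k.factorial := by
  rw [← rising_one]
  exact rising_mono k (by linarith [hy.2]) (by linarith [hy.1])

lemma rising_succ_neg (k : ℕ) (y : ℝ) : rising (k + 1) (-y) = -(y * rising k (1 - y)) := by
  rw [rising_succ_left, neg_add_eq_sub, neg_mul]

lemma rising_succ_neg_nonpos (k : ℕ) {y : ℝ} (hy : y ∈ Set.Icc (0 : ℝ) 1) :
    rising (k + 1) (-y) ≤ 0 := by
  rw [rising_succ_neg]
  exact neg_nonpos.2 (mul_nonneg hy.1 (rising_nonneg k (sub_nonneg.2 hy.2)))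

lemma abs_rising_succ_neg_le (k : ℕ) {y : ℝ} (hy : y ∈ Set.Icc (0 : ℝ) 1) :
    |rising (k + 1) (-y)| ≤ k.factorial := by
  have rising_nonneg := rising_nonneg k (sub_nonneg.2 hy.2)
  rw [rising_succ_neg, abs_neg, abs_of_nonneg (mul_nonneg hy.1 rising_nonneg)]
  exact (mul_le_of_le_one_left rising_nonneg hy.2).trans (rising_one_sub_le_factorial k hy)

lemma sum_rising_neg_div_factorial (K : ℕ) (y : ℝ) :
    ∑ k ∈ Finset.range (K + 1), rising k (-y) / k.factorial = rising K (1 - y) / K.factorial := by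
  induction K with
  | zero => simp
  | succ K ih =>
    rw [Finset.sum_range_succ, ih, rising_succ_neg, rising_succ, Nat.factorial_succ]
    push_cast
    field_simp
    ring

lemma sum_abs_rising_neg_div_factorial_le (K : ℕ) {y : ℝ} (hy : y ∈ Set.Icc (0 : ℝ) 1) :
    ∑ k ∈ Finset.range K, |rising (k + 1) (-y)| / (k + 1).factorial ≤ 1 := by
  have sum_eq := sum_rising_neg_div_factorial K y
  rw [Finset.sum_range_succ', rising_zero, Nat.factorial_zero, Nat.cast_one, div_one] at sum_eq
  have quotient_nonneg : 0 ≤ rising K (1 - y) / K.factorial :=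
    div_nonneg (rising_nonneg K (sub_nonneg.2 hy.2)) (Nat.cast_nonneg _)
  simp only [abs_of_nonpos (rising_succ_neg_nonpos _ hy), neg_div, Finset.sum_neg_distrib]
  linarith

lemma one_div_rising_sub {x : ℝ} (hx : 0 < x) (k : ℕ) :
    1 / rising (k + 1) x - 1 / rising (k + 1) (x + 1) = ((k : ℝ) + 1) / rising (k + 2) x := by
  have rising_ne := (rising_pos (k + 1) hx).ne'
  have rising_add_one_ne := (rising_pos (k + 1) (add_pos hx one_pos)).ne'
  have succ_left := rising_succ_left (k + 1) x
  have succ_right := rising_succ (k + 1) x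
  rw [div_sub_div _ _ rising_ne rising_add_one_ne,
    div_eq_div_iff (mul_ne_zero rising_ne rising_add_one_ne) (rising_pos (k + 2) hx).ne']
  push_cast at succ_right
  linear_combination rising (k + 1) (x + 1) * succ_right - rising (k + 1) x * succ_left

theorem one_div_add_eq_sum_rising {x y : ℝ} (hx : 0 < x) (hxy : x + y ≠ 0) (K : ℕ) :
    1 / (x + y) = ∑ k ∈ Finset.range K, rising k (-y) / rising (k + 1) x
      + rising K (-y) / (rising K x * (x + y)) := by
  induction K with
  | zero => simp
  | succ K ih =>
    rw [Finset.sum_range_succ, ih, rising_succ K, rising_succ K]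
    have rising_pos := rising_pos K hx
    have add_natCast_ne : x + (K : ℝ) ≠ 0 := by positivity
    field_simp
    ring

lemma abs_one_div_add_sub_sum_rising_le {x y : ℝ} (hx : 1 ≤ x) (hy : y ∈ Set.Icc (0 : ℝ) 1)
    (K : ℕ) :
    |1 / (x + y) - ∑ k ∈ Finset.range (K + 1), rising k (-y) / rising (k + 1) x|
      ≤ 1 / ((K : ℝ) + 1) := by
  have one_le_add : 1 ≤ x + y := by linarith [hy.1]
  have factorial_le := factorial_le_rising (K + 1) hx
  have rising_pos := rising_pos (K + 1) (one_pos.trans_le hx)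
  rw [one_div_add_eq_sum_rising (by linarith) (by linarith) (K + 1), add_sub_cancel_left, abs_div,
    abs_of_pos (mul_pos rising_pos (by linarith))]
  calc |rising (K + 1) (-y)| / (rising (K + 1) x * (x + y))
      ≤ K.factorial / ((K + 1).factorial * 1) := by
        gcongr
        exact abs_rising_succ_neg_le K hy
    _ = 1 / ((K : ℝ) + 1) := by
        rw [Nat.factorial_succ]
        push_cast
        field_simp

end RisingFactorials

section Signs

lemma gregoryMoment_eq_integral (j : ℕ) :
    gregoryMoment j = ∫ y in (0 : ℝ)..1, rising j (-y) := by
  have hasDerivAt_neg_antiderivative : ∀ y : ℝ,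
      HasDerivAt (fun y => -(antiderivative (ascPochhammer ℝ j)).eval (-y)) (rising j (-y)) y := by
    intro y
    have h := ((antiderivative (ascPochhammer ℝ j)).hasDerivAt (-y)).comp y (hasDerivAt_neg y)
    rw [derivative_antiderivative] at h
    exact h.neg.congr_deriv (by rw [rising]; ring)
  rw [intervalIntegral.integral_eq_sub_of_hasDerivAt (fun y _ => hasDerivAt_neg_antiderivative y)
    (((continuous_rising j).comp continuous_neg).intervalIntegrable _ _), gregoryMoment, neg_zero,
    antiderivative_eval_zero, neg_zero, sub_zero]

lemma gregoryMoment_succ_nonpos (j : ℕ) : gregoryMoment (j + 1) ≤ 0 := by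
  rw [gregoryMoment_eq_integral, ← neg_nonneg, ← intervalIntegral.integral_neg]
  exact intervalIntegral.integral_nonneg zero_le_one fun y hy =>
    neg_nonneg.2 (rising_succ_neg_nonpos j hy)

lemma logDiffCoeff_nonneg {k m : ℕ} (h : k ≤ m) : 0 ≤ logDiffCoeff k m := by
  induction k generalizing m with
  | zero => rw [logDiffCoeff]
  | succ k ih =>
    match k, m with
    | _, 0 => omega
    | 0, m + 1 => simpa [logDiffCoeff] using gregoryMoment_succ_nonpos m
    | k + 1, m + 1 =>
      rw [logDiffCoeff]
      exact mul_nonneg (by positivity) (ih (by omega))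

lemma logDiffCoeff_self (k : ℕ) : logDiffCoeff (k + 1) k = -(1 / ((k : ℝ) + 1)) := by
  induction k with
  | zero => simp [logDiffCoeff, gregoryMoment_zero]
  | succ k ih =>
    rw [logDiffCoeff, ih]
    push_cast
    field_simp
    ring

lemma harmonicMatrix_self (k : ℕ) : harmonicMatrix k k = -(harmonic k : ℝ) := by
  induction k with
  | zero => simp [harmonicMatrix]
  | succ k ih =>
    rw [harmonicMatrix, ih, logDiffCoeff_self, harmonicMatrix_eq_zero k.lt_succ_self,
      harmonic_succ]
    push_cast
    field_simp
    ring

lemma harmonicMatrix_nonneg {m k : ℕ} (h : k < m) : 0 ≤ harmonicMatrix m k := by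
  induction m generalizing k with
  | zero => omega
  | succ m ih =>
    match k with
    | 0 => rw [harmonicMatrix]
    | k + 1 =>
      have mul_nonneg : 0 ≤ ((m : ℝ) - (k + 1)) * harmonicMatrix m (k + 1) := by
        rcases (show k + 1 ≤ m by omega).eq_or_lt with rfl | k_lt
        · simp
        · exact mul_nonneg (sub_nonneg.2 (by exact_mod_cast k_lt.le)) (ih k_lt)
      rw [harmonicMatrix]
      exact add_nonneg (add_nonneg (ih (by omega)) mul_nonneg) (logDiffCoeff_nonneg (by omega))

end Signs

section BernoulliMoments

open Polynomial hiding bernoulli sum_bernoulli bernoulli_zero bernoulli_one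

lemma integral_half_sub_mul_pow (l : ℕ) :
    ∫ y in (0 : ℝ)..1, (1 / 2 - y) * y ^ l
      = -((l : ℝ) / 2 / (((l : ℝ) + 1) * ((l : ℝ) + 2))) := by
  have integrand_eq : ∀ y : ℝ, (1 / 2 - y) * y ^ l = 1 / 2 * y ^ l - y ^ (l + 1) :=
    fun y => by ring
  simp only [integrand_eq]
  rw [intervalIntegral.integral_sub (by apply Continuous.intervalIntegrable; fun_prop)
    (by apply Continuous.intervalIntegrable; fun_prop), intervalIntegral.integral_const_mul,
    integral_pow, integral_pow, one_pow, one_pow, zero_pow (by omega), zero_pow (by omega)]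
  push_cast
  field_simp
  ring

lemma choose_mul_bernoulliMoment (l j : ℕ) :
    (l.choose j : ℝ) * bernoulliMoment j * (((l : ℝ) + 1) * ((l : ℝ) + 2))
      = ((l + 2).choose (j + 2) : ℝ) * (bernoulli (j + 2) : ℝ) := by
  have choose_succ : ((l : ℝ) + 1) * l.choose j = (l + 1).choose (j + 1) * ((j : ℝ) + 1) := by
    exact_mod_cast Nat.add_one_mul_choose_eq l j
  have choose_succ_succ :
      ((l : ℝ) + 2) * (l + 1).choose (j + 1) = (l + 2).choose (j + 2) * ((j : ℝ) + 2) := by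
    exact_mod_cast Nat.add_one_mul_choose_eq (l + 1) (j + 1)
  rw [bernoulliMoment]
  field_simp
  linear_combination (bernoulli (j + 2) : ℝ) * (((l : ℝ) + 2) * choose_succ
    + ((j : ℝ) + 1) * choose_succ_succ)

lemma sum_choose_mul_bernoulliMoment (l : ℕ) :
    ∑ j ∈ Finset.range l, (l.choose j : ℝ) * bernoulliMoment j
      = (l : ℝ) / 2 / (((l : ℝ) + 1) * ((l : ℝ) + 2)) := by
  have bernoulli_recurrence := congrArg (Rat.cast (K := ℝ)) (sum_bernoulli (l + 2))
  rw [if_neg (by omega), Finset.sum_range_succ', Finset.sum_range_succ'] at bernoulli_recurrence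
  simp only [bernoulli_zero, bernoulli_one, zero_add, Nat.choose_zero_right,
    Nat.choose_one_right] at bernoulli_recurrence
  rw [eq_div_iff (by positivity), Finset.sum_mul]
  simp only [choose_mul_bernoulliMoment]
  push_cast at bernoulli_recurrence
  linear_combination bernoulli_recurrence

lemma momentFunctional_backwardDiff_X_pow (l : ℕ) :
    momentFunctional bernoulliMoment (backwardDiff (X ^ l))
      = ∫ y in (0 : ℝ)..1, (1 / 2 - y) * (-y) ^ l := by
  have choose_reflect : ∀ j ∈ Finset.range l,
      bernoulliMoment j * ((l.choose j : ℝ) * (-1) ^ (l - j))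
        = (-1) ^ l * ((l.choose j : ℝ) * bernoulliMoment j) := by
    intro j hj
    have sign_split : (-1 : ℝ) ^ l = (-1) ^ (l - j) * (-1) ^ j := by
      rw [← pow_add, Nat.sub_add_cancel (Finset.mem_range.1 hj).le]
    rw [sign_split]
    linear_combination (-(l.choose j : ℝ) * (-1) ^ (l - j)) * neg_one_pow_mul_bernoulliMoment j
  have integrand_eq : ∀ y : ℝ, (1 / 2 - y) * (-y) ^ l = (-1) ^ l * ((1 / 2 - y) * y ^ l) :=
    fun y => by rw [neg_pow]; ring
  simp only [integrand_eq, intervalIntegral.integral_const_mul, integral_half_sub_mul_pow]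
  rw [backwardDiff_X_pow, map_neg, map_sum]
  simp only [momentFunctional_monomial]
  rw [Finset.sum_congr rfl choose_reflect, ← Finset.mul_sum, sum_choose_mul_bernoulliMoment,
    mul_neg]

theorem momentFunctional_backwardDiff (p : ℝ[X]) :
    momentFunctional bernoulliMoment (backwardDiff p)
      = ∫ y in (0 : ℝ)..1, (1 / 2 - y) * p.eval (-y) := by
  have intervalIntegrable : ∀ p : ℝ[X], IntervalIntegrable (fun y => (1 / 2 - y) * p.eval (-y))
      MeasureTheory.volume 0 1 := fun p => Continuous.intervalIntegrable (by fun_prop) _ _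
  induction p using Polynomial.induction_on' with
  | add p q hp hq =>
    simp only [map_add, eval_add, mul_add, hp, hq,
      intervalIntegral.integral_add (intervalIntegrable p) (intervalIntegrable q)]
  | monomial l a =>
    rw [← mul_one a, ← smul_eq_mul, ← smul_monomial, monomial_one_right_eq_X_pow, map_smul,
      map_smul, momentFunctional_backwardDiff_X_pow, smul_eq_mul,
      ← intervalIntegral.integral_const_mul]
    simp only [eval_smul, eval_pow, eval_X, smul_eq_mul, mul_left_comm]

lemma integral_half_sub_mul_rising_zero :
    ∫ y in (0 : ℝ)..1, (1 / 2 - y) * rising 0 (-y) = 0 := by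
  simpa using integral_half_sub_mul_pow 0

/-- The coefficients `b_k` of the convergent Euler–Maclaurin formula, including `b_0`. -/
noncomputable def eulerMaclaurinCoeff (k : ℕ) : ℝ :=
  momentFunctional bernoulliMoment (ascPochhammer ℝ k)

theorem integral_half_sub_mul_rising_succ (k : ℕ) :
    ∫ y in (0 : ℝ)..1, (1 / 2 - y) * rising (k + 1) (-y)
      = ((k : ℝ) + 1) * eulerMaclaurinCoeff k := by
  have h := momentFunctional_backwardDiff (ascPochhammer ℝ (k + 1))
  rw [backwardDiff_ascPochhammer_succ, map_smul, smul_eq_mul] at h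
  exact h.symm

lemma abs_eulerMaclaurinCoeff_div_factorial_le (k : ℕ) :
    |eulerMaclaurinCoeff k| / (k.factorial : ℝ)
      ≤ ∫ y in (0 : ℝ)..1, |rising (k + 1) (-y)| / (k + 1).factorial := by
  have eq_integral : |eulerMaclaurinCoeff k| / (k.factorial : ℝ)
      = |∫ y in (0 : ℝ)..1, (1 / 2 - y) * rising (k + 1) (-y)| / (k + 1).factorial := by
    rw [integral_half_sub_mul_rising_succ, abs_mul,
      abs_of_nonneg (show (0 : ℝ) ≤ (k : ℝ) + 1 by positivity), Nat.factorial_succ]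
    push_cast
    field_simp
  rw [eq_integral, intervalIntegral.integral_div]
  refine div_le_div_of_nonneg_right ?_ (by positivity)
  refine (intervalIntegral.abs_integral_le_integral_abs zero_le_one).trans ?_
  refine intervalIntegral.integral_mono_on zero_le_one
    (Continuous.intervalIntegrable (by fun_prop) _ _)
    (Continuous.intervalIntegrable (by fun_prop) _ _) fun y hy => ?_
  rw [abs_mul]
  exact mul_le_of_le_one_left (abs_nonneg _) (abs_le.2 ⟨by linarith [hy.2], by linarith [hy.1]⟩)

theorem summable_abs_eulerMaclaurinCoeff_div_factorial :
    Summable fun k : ℕ => |eulerMaclaurinCoeff k| / (k.factorial : ℝ) := by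
  refine summable_of_sum_range_le (c := 1) (fun k => by positivity) fun K => ?_
  have intervalIntegrable : ∀ k : ℕ, IntervalIntegrable
      (fun y : ℝ => |rising (k + 1) (-y)| / (k + 1).factorial) MeasureTheory.volume 0 1 :=
    fun k => Continuous.intervalIntegrable (by fun_prop) _ _
  calc ∑ k ∈ Finset.range K, |eulerMaclaurinCoeff k| / (k.factorial : ℝ)
      ≤ ∑ k ∈ Finset.range K, ∫ y in (0 : ℝ)..1, |rising (k + 1) (-y)| / (k + 1).factorial :=
        Finset.sum_le_sum fun k _ => abs_eulerMaclaurinCoeff_div_factorial_le k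
    _ = ∫ y in (0 : ℝ)..1, ∑ k ∈ Finset.range K, |rising (k + 1) (-y)| / (k + 1).factorial :=
        (intervalIntegral.integral_finsetSum fun k _ => intervalIntegrable k).symm
    _ ≤ ∫ _ in (0 : ℝ)..1, (1 : ℝ) :=
        intervalIntegral.integral_mono_on zero_le_one
          (Continuous.intervalIntegrable (by fun_prop) _ _) intervalIntegrable_const
          fun y hy => sum_abs_rising_neg_div_factorial_le K hy
    _ = 1 := by simp

end BernoulliMoments

section NewtonCoefficients

/-- The coefficient `(-1)^k Δ^k f (x) / k!` of `(-y)_k` in the Newton series of `f (x + y)`, with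
`Δ f (x) = f (x + 1) - f x`. -/
noncomputable def newtonCoeff (f : ℝ → ℝ) (k : ℕ) (x : ℝ) : ℝ :=
  (-1) ^ k * (fwdDiff 1)^[k] f x / k.factorial

@[simp]
lemma newtonCoeff_zero (f : ℝ → ℝ) : newtonCoeff f 0 = f := by
  ext x
  simp [newtonCoeff]

lemma newtonCoeff_succ (f : ℝ → ℝ) (k : ℕ) (x : ℝ) :
    newtonCoeff f (k + 1) x = (newtonCoeff f k x - newtonCoeff f k (x + 1)) / ((k : ℝ) + 1) := by
  simp only [newtonCoeff, Function.iterate_succ_apply', fwdDiff, Nat.factorial_succ]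
  push_cast
  field_simp
  ring

lemma succ_mul_newtonCoeff_succ (f : ℝ → ℝ) (k : ℕ) (x : ℝ) :
    ((k : ℝ) + 1) * newtonCoeff f (k + 1) x = newtonCoeff f k x - newtonCoeff f k (x + 1) := by
  rw [newtonCoeff_succ]
  field_simp

lemma newtonCoeff_id_mul_succ (f : ℝ → ℝ) (k : ℕ) (x : ℝ) :
    newtonCoeff (fun v => v * f v) (k + 1) x
      = (x + (k + 1)) * newtonCoeff f (k + 1) x - newtonCoeff f k x := by
  induction k generalizing x with
  | zero =>
    simp only [newtonCoeff_succ, newtonCoeff_zero]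
    push_cast
    ring
  | succ k ih =>
    have diff_f := succ_mul_newtonCoeff_succ f (k + 1) x
    have diff_f_prev := succ_mul_newtonCoeff_succ f k x
    rw [newtonCoeff_succ, ih, ih, div_eq_iff (by positivity)]
    push_cast at diff_f ⊢
    linear_combination diff_f_prev - (x + k + 2) * diff_f

lemma add_mul_sum_rising_mul_newtonCoeff (f : ℝ → ℝ) (x y : ℝ) (K : ℕ) :
    (x + y) * ∑ k ∈ Finset.range (K + 1), rising k (-y) * newtonCoeff f k x
      = ∑ k ∈ Finset.range (K + 1), rising k (-y) * newtonCoeff (fun v => v * f v) k x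
        - rising (K + 1) (-y) * newtonCoeff f K x := by
  induction K with
  | zero =>
    simp [rising_succ]
    ring
  | succ K ih =>
    rw [Finset.sum_range_succ, mul_add, ih, Finset.sum_range_succ _ (K + 1),
      newtonCoeff_id_mul_succ, rising_succ (K + 1)]
    push_cast
    ring

lemma log_eq_id_mul_log_div : Real.log = fun v => v * (Real.log v / v) := by
  ext v
  rcases eq_or_ne v 0 with rfl | hv
  · simp
  · rw [mul_div_cancel₀ _ hv]

lemma hasDerivAt_newtonCoeff_log {x : ℝ} (hx : 0 < x) (k : ℕ) :
    HasDerivAt (newtonCoeff Real.log k) (1 / rising (k + 1) x) x := by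
  induction k generalizing x with
  | zero => simpa [rising_succ] using Real.hasDerivAt_log hx.ne'
  | succ k ih =>
    rw [funext (newtonCoeff_succ Real.log k)]
    have hasDerivAt_shift := (ih (add_pos hx one_pos)).comp_add_const x 1
    refine (((ih hx).sub hasDerivAt_shift).div_const ((k : ℝ) + 1)).congr_deriv ?_
    rw [one_div_rising_sub hx]
    field_simp

lemma abs_newtonCoeff_log_succ_le {x : ℝ} (hx : 0 < x) (k : ℕ) :
    |newtonCoeff Real.log (k + 1) x| ≤ 1 / (((k : ℝ) + 1) * rising (k + 1) x) := by
  obtain ⟨c, hc, slope_eq⟩ := exists_hasDerivAt_eq_slope (newtonCoeff Real.log k)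
    (fun v => 1 / rising (k + 1) v) (lt_add_one x)
    (HasDerivAt.continuousOn fun v hv => hasDerivAt_newtonCoeff_log (hx.trans_le hv.1) k)
    (fun v hv => hasDerivAt_newtonCoeff_log (hx.trans hv.1) k)
  have rising_pos_c := rising_pos (k + 1) (hx.trans hc.1)
  have rising_pos_x := rising_pos (k + 1) hx
  have newtonCoeff_eq :
      newtonCoeff Real.log (k + 1) x = -(1 / (((k : ℝ) + 1) * rising (k + 1) c)) := by
    rw [add_sub_cancel_left, div_one] at slope_eq
    rw [newtonCoeff_succ, mul_comm, ← div_div, slope_eq, ← neg_div, neg_sub]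
  rw [newtonCoeff_eq, abs_neg, abs_of_pos (by positivity)]
  gcongr
  exact rising_mono (k + 1) hx.le hc.1.le

end NewtonCoefficients

section Harmonic

lemma harmonic_cast_nonneg (k : ℕ) : (0 : ℝ) ≤ harmonic k := by
  exact_mod_cast (Finset.sum_nonneg fun i _ => by positivity : (0 : ℚ) ≤ harmonic k)

lemma harmonic_cast_le (k : ℕ) : (harmonic k : ℝ) ≤ k := by
  induction k with
  | zero => simp
  | succ k ih =>
    rw [harmonic_succ]
    push_cast
    exact add_le_add ih (inv_le_one_of_one_le₀ (by linarith [Nat.cast_nonneg (α := ℝ) k]))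

lemma tendsto_harmonic_div_succ :
    Tendsto (fun k : ℕ => (harmonic k : ℝ) / ((k : ℝ) + 1)) atTop (𝓝 0) := by
  have cesaro : Tendsto (fun k : ℕ => (k : ℝ)⁻¹ * ∑ i ∈ Finset.range k, 1 / ((i : ℝ) + 1)) atTop
      (𝓝 0) := tendsto_one_div_add_atTop_nhds_zero_nat.cesaro
  refine squeeze_zero' (Eventually.of_forall fun k => ?_) ?_ cesaro
  · exact div_nonneg (harmonic_cast_nonneg k) (by positivity)
  filter_upwards [eventually_gt_atTop 0] with k hk
  have harmonic_eq : (harmonic k : ℝ) = ∑ i ∈ Finset.range k, 1 / ((i : ℝ) + 1) := by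
    simp [harmonic]
  rw [← harmonic_eq, inv_mul_eq_div]
  have := harmonic_cast_nonneg k
  gcongr
  linarith

/-- The part of `newtonCoeff (log v / v) k x` that remains when its term `log x / (x)_{k+1}` is
removed: a rational function of `x`, `log (x + 1) - log x`, …, `log (x + k) - log x`. -/
noncomputable def newtonCoeffPlain (k : ℕ) (x : ℝ) : ℝ :=
  newtonCoeff (fun v => Real.log v / v) k x - Real.log x / rising (k + 1) x

lemma newtonCoeff_log_div_eq (k : ℕ) (x : ℝ) :
    newtonCoeff (fun v => Real.log v / v) k x
      = Real.log x / rising (k + 1) x + newtonCoeffPlain k x :=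
  (add_sub_cancel _ _).symm

lemma newtonCoeffPlain_zero (x : ℝ) : newtonCoeffPlain 0 x = 0 := by
  simp [newtonCoeffPlain, rising_succ]

lemma newtonCoeffPlain_succ {x : ℝ} (hx : 0 < x) (k : ℕ) :
    (x + (k + 1)) * newtonCoeffPlain (k + 1) x
      = newtonCoeffPlain k x + newtonCoeff Real.log (k + 1) x := by
  have leibniz := newtonCoeff_id_mul_succ (fun v => Real.log v / v) k x
  rw [← log_eq_id_mul_log_div] at leibniz
  have rising_pos := rising_pos (k + 1) hx
  rw [leibniz, newtonCoeffPlain, newtonCoeffPlain, rising_succ (k + 1)]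
  field_simp
  push_cast
  ring

lemma abs_newtonCoeffPlain_le {x : ℝ} (hx : 0 < x) (k : ℕ) :
    |newtonCoeffPlain k x| ≤ harmonic k / rising (k + 1) x := by
  induction k with
  | zero => simp [newtonCoeffPlain_zero]
  | succ k ih =>
    have add_pos : 0 < x + ((k : ℝ) + 1) := by positivity
    have rising_pos := rising_pos (k + 1) hx
    rw [← mul_le_mul_iff_right₀ add_pos]
    calc (x + ((k : ℝ) + 1)) * |newtonCoeffPlain (k + 1) x|
        = |newtonCoeffPlain k x + newtonCoeff Real.log (k + 1) x| := by
          rw [← newtonCoeffPlain_succ hx, abs_mul, abs_of_pos add_pos]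
      _ ≤ harmonic k / rising (k + 1) x + 1 / (((k : ℝ) + 1) * rising (k + 1) x) :=
          (abs_add_le _ _).trans (add_le_add ih (abs_newtonCoeff_log_succ_le hx k))
      _ = (x + ((k : ℝ) + 1)) * (harmonic (k + 1) / rising (k + 1 + 1) x) := by
          rw [rising_succ (k + 1), harmonic_succ]
          push_cast
          field_simp

lemma abs_newtonCoeff_log_div_le {x : ℝ} (hx : 1 ≤ x) (k : ℕ) :
    |newtonCoeff (fun v => Real.log v / v) k x|
      ≤ (Real.log x + harmonic k) / rising (k + 1) x := by
  have x_pos : 0 < x := by linarith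
  have log_term_nonneg := div_nonneg (Real.log_nonneg hx) (rising_pos (k + 1) x_pos).le
  rw [newtonCoeff_log_div_eq, add_div]
  exact (abs_add_le _ _).trans
    (add_le_add (abs_of_nonneg log_term_nonneg).le (abs_newtonCoeffPlain_le x_pos k))

end Harmonic

section FactorialSeries

lemma summable_of_eventually_nonneg_of_sum_range_le {a : ℕ → ℝ} {B : ℝ}
    (ha : ∀ᶠ m in atTop, 0 ≤ a m) (hB : ∀ᶠ N in atTop, ∑ m ∈ Finset.range N, a m ≤ B) :
    Summable a := by
  obtain ⟨M, hM⟩ := eventually_atTop.1 (ha.and hB)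
  rw [← summable_nat_add_iff M]
  refine summable_of_sum_range_le (c := B - ∑ m ∈ Finset.range M, a m)
    (fun m => (hM _ (Nat.le_add_left M m)).1) fun N => ?_
  simp only [add_comm _ M]
  rw [le_sub_iff_add_le', ← Finset.sum_range_add]
  exact (hM _ (Nat.le_add_right M N)).2

lemma eq_zero_of_tendsto_mul_of_summable {a : ℕ → ℝ} {ρ : ℝ} (ha : Summable a)
    (h : Tendsto (fun N : ℕ => (N : ℝ) * a N) atTop (𝓝 ρ)) : ρ = 0 := by
  by_contra hρ
  have inv_isBigO : (fun N : ℕ => 1 / (N : ℝ)) =O[atTop] a := by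
    have mul_inv_isBigO := (Asymptotics.isBigO_refl a atTop).mul ((h.inv₀ hρ).isBigO_one ℝ)
    refine mul_inv_isBigO.congr' ?_ (by simp)
    filter_upwards [h.eventually_ne hρ] with N hN
    rw [mul_inv, mul_left_comm, mul_inv_cancel₀ (right_ne_zero_of_mul hN), mul_one, one_div]
  exact Real.not_summable_one_div_natCast (summable_of_isBigO_nat ha.norm inv_isBigO.norm_right)

lemma summable_of_mul_sum_range_succ_eq {a q : ℕ → ℝ} {c d L : ℝ} (hc : 0 < c)
    (ha : ∀ᶠ m in atTop, 0 ≤ a m) (hq : Tendsto q atTop (𝓝 L))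
    (h : ∀ N : ℕ, c * ∑ m ∈ Finset.range (N + 1), a m = q N + (d - N) * a N) : Summable a := by
  obtain ⟨B, hB⟩ := hq.bddAbove_range
  refine summable_of_eventually_nonneg_of_sum_range_le (B := B / c) ha ?_
  rw [← map_add_atTop_eq_nat 1, eventually_map]
  filter_upwards [ha, eventually_ge_atTop ⌈d⌉₊] with N a_nonneg hdN
  have boundary_nonpos : (d - N) * a N ≤ 0 :=
    mul_nonpos_of_nonpos_of_nonneg (sub_nonpos.2 (Nat.ceil_le.1 hdN)) a_nonneg
  rw [le_div_iff₀ hc, mul_comm, h]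
  linarith [hB ⟨N, rfl⟩]

lemma hasSum_of_mul_sum_range_succ_eq {a q : ℕ → ℝ} {c d L : ℝ} (hc : 0 < c)
    (ha : ∀ᶠ m in atTop, 0 ≤ a m) (hq : Tendsto q atTop (𝓝 L))
    (h : ∀ N : ℕ, c * ∑ m ∈ Finset.range (N + 1), a m = q N + (d - N) * a N) :
    HasSum a (L / c) := by
  have summable := summable_of_mul_sum_range_succ_eq hc ha hq h
  have tendsto_mul : Tendsto (fun N : ℕ => (N : ℝ) * a N) atTop
      (𝓝 (L + d * 0 - c * ∑' m, a m)) := by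
    have tendsto_sum := summable.hasSum.tendsto_sum_nat.comp (tendsto_add_atTop_nat 1)
    refine ((hq.add (summable.tendsto_atTop_zero.const_mul d)).sub
      (tendsto_sum.const_mul c)).congr fun N => ?_
    simp only [Function.comp_apply, h]
    ring
  have limit_eq := eq_zero_of_tendsto_mul_of_summable summable tendsto_mul
  rw [show L / c = ∑' m, a m by rw [div_eq_iff hc.ne']; linarith]
  exact summable.hasSum

lemma integral_one_div_add {x y : ℝ} (hx : 0 < x) (hy : 0 ≤ y) :
    ∫ z in (0 : ℝ)..y, 1 / (x + z) = Real.log (x + y) - Real.log x := by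
  rw [intervalIntegral.integral_comp_add_left (fun z => 1 / z), add_zero,
    integral_one_div_of_pos hx (by linarith), Real.log_div (by linarith) hx.ne']

lemma sum_logDiffCoeff_one_div_rising (x : ℝ) (M : ℕ) :
    ∑ m ∈ Finset.range M, logDiffCoeff 1 m / rising (m + 1) x
      = -∫ z in (0 : ℝ)..1, ∑ m ∈ Finset.range M, rising m (-z) / rising (m + 1) x := by
  rw [intervalIntegral.integral_finsetSum
    fun m _ => Continuous.intervalIntegrable (by fun_prop) _ _, ← Finset.sum_neg_distrib]
  refine Finset.sum_congr rfl fun m _ => ?_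
  rw [intervalIntegral.integral_div, logDiffCoeff, gregoryMoment_eq_integral, neg_div]

lemma abs_sum_logDiffCoeff_one_div_rising_sub_le {x : ℝ} (hx : 1 ≤ x) (M : ℕ) :
    |∑ m ∈ Finset.range (M + 1), logDiffCoeff 1 m / rising (m + 1) x
      - newtonCoeff Real.log 1 x| ≤ 1 / ((M : ℝ) + 1) := by
  have newtonCoeff_eq : newtonCoeff Real.log 1 x = -∫ z in (0 : ℝ)..1, 1 / (x + z) := by
    rw [integral_one_div_add (by linarith) zero_le_one]
    simp [newtonCoeff_succ]
  have intervalIntegrable : IntervalIntegrable (fun z => 1 / (x + z)) MeasureTheory.volume 0 1 := by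
    refine ContinuousOn.intervalIntegrable fun z hz => ?_
    rw [Set.uIcc_of_le zero_le_one] at hz
    have add_ne : x + z ≠ 0 := by linarith [hz.1]
    exact ContinuousAt.continuousWithinAt (by fun_prop (disch := assumption))
  rw [sum_logDiffCoeff_one_div_rising, newtonCoeff_eq, sub_neg_eq_add, neg_add_eq_sub,
    ← intervalIntegral.integral_sub intervalIntegrable
      (Continuous.intervalIntegrable (by fun_prop) _ _)]
  have norm_le := intervalIntegral.norm_integral_le_of_norm_le_const (a := 0) (b := 1)
    (C := 1 / ((M : ℝ) + 1))
    (f := fun z => 1 / (x + z) - ∑ m ∈ Finset.range (M + 1), rising m (-z) / rising (m + 1) x)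
    fun z hz => by
      rw [Set.uIoc_of_le zero_le_one] at hz
      exact abs_one_div_add_sub_sum_rising_le hx ⟨hz.1.le, hz.2⟩ M
  rwa [sub_zero, abs_one, mul_one, Real.norm_eq_abs] at norm_le

lemma hasSum_logDiffCoeff_one_div_rising {x : ℝ} (hx : 1 ≤ x) :
    HasSum (fun m => logDiffCoeff 1 m / rising (m + 1) x) (newtonCoeff Real.log 1 x) := by
  have tendsto_sum : Tendsto (fun M => ∑ m ∈ Finset.range M, logDiffCoeff 1 m / rising (m + 1) x)
      atTop (𝓝 (newtonCoeff Real.log 1 x)) := by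
    rw [← tendsto_add_atTop_iff_nat 1, tendsto_iff_norm_sub_tendsto_zero]
    exact squeeze_zero (fun M => norm_nonneg _) (abs_sum_logDiffCoeff_one_div_rising_sub_le hx)
      tendsto_one_div_add_atTop_nhds_zero_nat
  have eventually_nonneg : ∀ᶠ m in atTop, 0 ≤ logDiffCoeff 1 m / rising (m + 1) x := by
    filter_upwards [eventually_ge_atTop 1] with m hm
    exact div_nonneg (logDiffCoeff_nonneg hm) (rising_nonneg _ (by linarith))
  have summable := summable_of_eventually_nonneg_of_sum_range_le eventually_nonneg
    (tendsto_sum.eventually_le_const (lt_add_one _))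
  exact (summable.hasSum_iff_tendsto_nat).2 tendsto_sum

theorem hasSum_logDiffCoeff_div_rising {x : ℝ} (hx : 1 ≤ x) (k : ℕ) :
    HasSum (fun m => logDiffCoeff (k + 1) m / rising (m + 1) x)
      (newtonCoeff Real.log (k + 1) x) := by
  induction k generalizing x with
  | zero => exact hasSum_logDiffCoeff_one_div_rising hx
  | succ k ih =>
    have diff_div :=
      ((ih hx).sub (ih (show 1 ≤ x + 1 by linarith))).div_const (((k + 1 : ℕ) : ℝ) + 1)
    rw [newtonCoeff_succ, ← hasSum_nat_add_iff' 1]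
    simp only [Finset.range_one, Finset.sum_singleton, logDiffCoeff, zero_div, sub_zero]
    refine diff_div.congr_fun fun m => ?_
    rw [div_eq_mul_one_div (logDiffCoeff (k + 1) m), div_eq_mul_one_div (logDiffCoeff (k + 1) m)
      (rising (m + 1) (x + 1)), ← mul_sub, one_div_rising_sub (one_pos.trans_le hx)]
    push_cast
    field_simp
    ring

lemma add_mul_sum_harmonicMatrix_div_rising {x : ℝ} (hx : 0 < x) (k N : ℕ) :
    (x + (k + 1)) * ∑ m ∈ Finset.range (N + 1), harmonicMatrix m (k + 1) / rising (m + 1) x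
      = ∑ m ∈ Finset.range N, (harmonicMatrix m k / rising (m + 1) x
          + logDiffCoeff (k + 1) m / rising (m + 1) x)
        + ((k : ℝ) + 1 - N) * (harmonicMatrix N (k + 1) / rising (N + 1) x) := by
  induction N with
  | zero => simp [harmonicMatrix]
  | succ N ih =>
    rw [Finset.sum_range_succ, mul_add, ih, Finset.sum_range_succ _ N, harmonicMatrix,
      rising_succ (N + 1)]
    have rising_pos := rising_pos (N + 1) hx
    field_simp
    push_cast
    ring

theorem hasSum_harmonicMatrix_div_rising {x : ℝ} (hx : 1 ≤ x) (k : ℕ) :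
    HasSum (fun m => harmonicMatrix m k / rising (m + 1) x) (newtonCoeffPlain k x) := by
  have x_pos : 0 < x := by linarith
  induction k with
  | zero =>
    simp only [newtonCoeffPlain_zero, harmonicMatrix_zero_right, zero_div]
    exact hasSum_zero
  | succ k ih =>
    have add_pos : 0 < x + ((k : ℝ) + 1) := by positivity
    have eventually_nonneg : ∀ᶠ m in atTop, 0 ≤ harmonicMatrix m (k + 1) / rising (m + 1) x := by
      filter_upwards [eventually_gt_atTop (k + 1)] with m hm
      exact div_nonneg (harmonicMatrix_nonneg hm) (rising_pos _ x_pos).le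
    rw [eq_div_of_mul_eq add_pos.ne' ((mul_comm _ _).trans (newtonCoeffPlain_succ x_pos k))]
    exact hasSum_of_mul_sum_range_succ_eq add_pos eventually_nonneg
      (ih.add (hasSum_logDiffCoeff_div_rising hx k)).tendsto_sum_nat
      (add_mul_sum_harmonicMatrix_div_rising x_pos k)

lemma hasSum_abs_harmonicMatrix_div_rising {x : ℝ} (hx : 1 ≤ x) (k : ℕ) :
    HasSum (fun m => |harmonicMatrix m k / rising (m + 1) x|)
      (newtonCoeffPlain k x + 2 * (harmonic k / rising (k + 1) x)) := by
  have diagonal : HasSum (fun m => if m = k then 2 * (harmonic k / rising (k + 1) x) else 0)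
      (2 * ((harmonic k : ℝ) / rising (k + 1) x)) := hasSum_ite_eq k _
  refine ((hasSum_harmonicMatrix_div_rising hx k).add diagonal).congr_fun fun m => ?_
  have rising_nonneg : 0 ≤ rising (m + 1) x := rising_nonneg (m + 1) (by linarith)
  rcases lt_trichotomy m k with h | rfl | h
  · simp [h.ne, harmonicMatrix_eq_zero h]
  · rw [if_pos rfl, harmonicMatrix_self, neg_div, abs_neg,
      abs_of_nonneg (div_nonneg (harmonic_cast_nonneg m) rising_nonneg)]
    ring
  · rw [if_neg h.ne', add_zero, abs_of_nonneg (div_nonneg (harmonicMatrix_nonneg h) rising_nonneg)]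

end FactorialSeries

section NewtonSeries

lemma le_of_tendsto_of_hasDerivAt_nonpos {f f' : ℝ → ℝ} {a l : ℝ}
    (hf : ∀ v, a ≤ v → HasDerivAt f (f' v) v) (hf' : ∀ v, a ≤ v → f' v ≤ 0)
    (hl : Tendsto f atTop (𝓝 l)) : l ≤ f a := by
  have antitone : AntitoneOn f (Set.Ici a) := by
    refine antitoneOn_of_hasDerivWithinAt_nonpos (convex_Ici a)
      (HasDerivAt.continuousOn fun v hv => hf v hv)
      (fun v hv => (hf v (interior_subset hv)).hasDerivWithinAt)
      fun v hv => hf' v (interior_subset hv)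
  refine le_of_tendsto hl ?_
  filter_upwards [eventually_ge_atTop a] with v hv
  exact antitone Set.self_mem_Ici hv hv

lemma abs_le_div_of_abs_deriv_le_div_sq {f f' : ℝ → ℝ} {a c : ℝ} (ha : 0 < a)
    (hf : ∀ v, a ≤ v → HasDerivAt f (f' v) v) (hf' : ∀ v, a ≤ v → |f' v| ≤ c / v ^ 2)
    (hl : Tendsto f atTop (𝓝 0)) : |f a| ≤ c / a := by
  have hasDerivAt_div (v : ℝ) (hv : a ≤ v) : HasDerivAt (fun v => c / v) (-(c / v ^ 2)) v := by
    simpa [div_eq_mul_inv] using (hasDerivAt_inv (ha.trans_le hv).ne').const_mul c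
  have tendsto_div : Tendsto (fun v : ℝ => c / v) atTop (𝓝 0) :=
    tendsto_const_nhds.div_atTop tendsto_id
  have sub_nonneg : 0 ≤ c / a - f a :=
    le_of_tendsto_of_hasDerivAt_nonpos (f := fun v => c / v - f v)
      (fun v hv => (hasDerivAt_div v hv).sub (hf v hv))
      (fun v hv => by linarith [(abs_le.1 (hf' v hv)).1]) (by simpa using tendsto_div.sub hl)
  have add_nonneg : 0 ≤ c / a + f a :=
    le_of_tendsto_of_hasDerivAt_nonpos (f := fun v => c / v + f v)
      (fun v hv => (hasDerivAt_div v hv).add (hf v hv))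
      (fun v hv => by linarith [(abs_le.1 (hf' v hv)).2]) (by simpa using tendsto_div.add hl)
  exact abs_le.2 ⟨by linarith, by linarith⟩

lemma tendsto_newtonCoeff_log_succ (k : ℕ) :
    Tendsto (newtonCoeff Real.log (k + 1)) atTop (𝓝 0) := by
  refine squeeze_zero_norm' ?_ tendsto_inv_atTop_zero
  filter_upwards [eventually_ge_atTop 1] with x hx
  have x_pos : 0 < x := by linarith
  have le_rising : x ≤ rising (k + 1) x :=
    (le_mul_of_one_le_left x_pos.le (by exact_mod_cast (k + 1).factorial_pos)).trans
      (factorial_succ_mul_le_rising k hx)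
  rw [Real.norm_eq_abs, ← one_div]
  refine (abs_newtonCoeff_log_succ_le x_pos k).trans (one_div_le_one_div_of_le x_pos ?_)
  exact le_rising.trans
    (le_mul_of_one_le_left (by linarith) (by linarith [Nat.cast_nonneg (α := ℝ) k]))

/-- The remainder of the Newton series `log (x + y) = ∑ k, (-y)_k * newtonCoeff log k x` after the
term of index `K`, as a function of `x`. -/
noncomputable def logNewtonRemainder (y : ℝ) (K : ℕ) (x : ℝ) : ℝ :=
  Real.log (x + y) - ∑ k ∈ Finset.range (K + 1), rising k (-y) * newtonCoeff Real.log k x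

lemma hasDerivAt_logNewtonRemainder {x y : ℝ} (hx : 0 < x) (hy : 0 ≤ y) (K : ℕ) :
    HasDerivAt (logNewtonRemainder y K) (rising (K + 1) (-y) / (rising (K + 1) x * (x + y))) x := by
  have add_ne_zero : x + y ≠ 0 := by positivity
  have hasDerivAt_log : HasDerivAt (fun v => Real.log (v + y)) (1 / (x + y)) x :=
    ((hasDerivAt_id x).add_const y).log add_ne_zero
  have hasDerivAt_sum := HasDerivAt.fun_sum (u := Finset.range (K + 1)) fun k _ =>
    (hasDerivAt_newtonCoeff_log hx k).const_mul (rising k (-y))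
  refine (hasDerivAt_log.sub hasDerivAt_sum).congr_deriv ?_
  rw [one_div_add_eq_sum_rising hx add_ne_zero (K + 1)]
  simp only [mul_one_div, add_sub_cancel_left]

lemma tendsto_logNewtonRemainder (y : ℝ) (K : ℕ) :
    Tendsto (logNewtonRemainder y K) atTop (𝓝 0) := by
  have tendsto_sum : Tendsto
      (fun x => ∑ k ∈ Finset.range K, rising (k + 1) (-y) * newtonCoeff Real.log (k + 1) x)
      atTop (𝓝 0) := by
    simpa using tendsto_finsetSum (Finset.range K) fun k _ =>
      (tendsto_newtonCoeff_log_succ k).const_mul (rising (k + 1) (-y))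
  have tendsto_sub := (Real.tendsto_log_comp_add_sub_log y).sub tendsto_sum
  rw [sub_zero] at tendsto_sub
  refine tendsto_sub.congr fun x => ?_
  rw [logNewtonRemainder, Finset.sum_range_succ', rising_zero, newtonCoeff_zero]
  ring

lemma abs_rising_succ_neg_div_rising_le {x y : ℝ} (hx : 1 ≤ x) (hy : y ∈ Set.Icc (0 : ℝ) 1)
    (K : ℕ) : |rising (K + 1) (-y)| / rising (K + 1) x ≤ 1 / (((K : ℝ) + 1) * x) := by
  have x_ne_zero : x ≠ 0 := by positivity
  have factorial_mul_le := factorial_succ_mul_le_rising K hx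
  calc |rising (K + 1) (-y)| / rising (K + 1) x
      ≤ K.factorial / ((K + 1).factorial * x) :=
        div_le_div₀ (by positivity) (abs_rising_succ_neg_le K hy) (by positivity) factorial_mul_le
    _ = 1 / (((K : ℝ) + 1) * x) := by
        rw [Nat.factorial_succ]
        push_cast
        field_simp

lemma abs_logNewtonRemainder_le {x y : ℝ} (hx : 1 ≤ x) (hy : y ∈ Set.Icc (0 : ℝ) 1) (K : ℕ) :
    |logNewtonRemainder y K x| ≤ 1 / ((K : ℝ) + 1) / x := by
  refine abs_le_div_of_abs_deriv_le_div_sq (by linarith)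
    (fun v hv => hasDerivAt_logNewtonRemainder (by linarith) hy.1 K) (fun v hv => ?_)
    (tendsto_logNewtonRemainder y K)
  have one_le : 1 ≤ v := hx.trans hv
  have rising_pos := rising_pos (K + 1) (show 0 < v by linarith)
  rw [abs_div, abs_of_pos (mul_pos rising_pos (by linarith [hy.1])), ← div_div]
  calc |rising (K + 1) (-y)| / rising (K + 1) v / (v + y)
      ≤ 1 / (((K : ℝ) + 1) * v) / v :=
        div_le_div₀ (by positivity) (abs_rising_succ_neg_div_rising_le one_le hy K)
          (by linarith) (by linarith [hy.1])
    _ = 1 / ((K : ℝ) + 1) / v ^ 2 := by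
        field_simp

lemma add_mul_log_div_sub_sum_rising {x y : ℝ} (hxy : x + y ≠ 0) (K : ℕ) :
    (x + y) * (Real.log (x + y) / (x + y)
        - ∑ k ∈ Finset.range (K + 1), rising k (-y) * newtonCoeff (fun v => Real.log v / v) k x)
      = logNewtonRemainder y K x
        + rising (K + 1) (-y) * newtonCoeff (fun v => Real.log v / v) K x := by
  rw [mul_sub, mul_div_cancel₀ _ hxy, add_mul_sum_rising_mul_newtonCoeff, ← log_eq_id_mul_log_div,
    logNewtonRemainder]
  ring

lemma abs_rising_succ_neg_mul_newtonCoeff_log_div_le {x y : ℝ} (hx : 1 ≤ x)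
    (hy : y ∈ Set.Icc (0 : ℝ) 1) (K : ℕ) :
    |rising (K + 1) (-y) * newtonCoeff (fun v => Real.log v / v) K x|
      ≤ (Real.log x + harmonic K) / ((K : ℝ) + 1) / x := by
  have numerator_nonneg : 0 ≤ Real.log x + harmonic K :=
    add_nonneg (Real.log_nonneg hx) (harmonic_cast_nonneg K)
  calc |rising (K + 1) (-y) * newtonCoeff (fun v => Real.log v / v) K x|
      ≤ |rising (K + 1) (-y)| * ((Real.log x + harmonic K) / rising (K + 1) x) := by
        rw [abs_mul]
        gcongr
        exact abs_newtonCoeff_log_div_le hx K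
    _ = (Real.log x + harmonic K) * (|rising (K + 1) (-y)| / rising (K + 1) x) := by ring
    _ ≤ (Real.log x + harmonic K) * (1 / (((K : ℝ) + 1) * x)) :=
        mul_le_mul_of_nonneg_left (abs_rising_succ_neg_div_rising_le hx hy K) numerator_nonneg
    _ = (Real.log x + harmonic K) / ((K : ℝ) + 1) / x := by rw [mul_one_div, div_div]

lemma abs_log_div_sub_sum_rising_le {x y : ℝ} (hx : 1 ≤ x) (hy : y ∈ Set.Icc (0 : ℝ) 1) (K : ℕ) :
    |Real.log (x + y) / (x + y)
        - ∑ k ∈ Finset.range (K + 1), rising k (-y) * newtonCoeff (fun v => Real.log v / v) k x|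
      ≤ (1 + Real.log x + harmonic K) / ((K : ℝ) + 1) / x := by
  have one_le_add : 1 ≤ x + y := by linarith [hy.1]
  refine (le_mul_of_one_le_left (abs_nonneg _) one_le_add).trans ?_
  nth_rewrite 1 [← abs_of_nonneg (zero_le_one.trans one_le_add)]
  rw [← abs_mul, add_mul_log_div_sub_sum_rising (by linarith)]
  refine (abs_add_le _ _).trans ((add_le_add (abs_logNewtonRemainder_le hx hy K)
    (abs_rising_succ_neg_mul_newtonCoeff_log_div_le hx hy K)).trans_eq ?_)
  ring

end NewtonSeries

section EulerMaclaurin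

lemma abs_integral_half_sub_mul_le {g : ℝ → ℝ} {c : ℝ}
    (hg : ∀ y ∈ Set.Icc (0 : ℝ) 1, |g y| ≤ c) :
    |∫ y in (0 : ℝ)..1, (1 / 2 - y) * g y| ≤ c := by
  have norm_le := intervalIntegral.norm_integral_le_of_norm_le_const (a := 0) (b := 1) (C := c)
    (f := fun y => (1 / 2 - y) * g y) fun y hy => by
      rw [Set.uIoc_of_le zero_le_one] at hy
      have half_sub_le : |1 / 2 - y| ≤ 1 := abs_le.2 ⟨by linarith [hy.2], by linarith [hy.1]⟩
      rw [Real.norm_eq_abs, abs_mul]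
      exact (mul_le_of_le_one_left (abs_nonneg _) half_sub_le).trans (hg y ⟨hy.1.le, hy.2⟩)
  rwa [sub_zero, abs_one, mul_one, Real.norm_eq_abs] at norm_le

lemma sum_eulerMaclaurinCoeff_mul_sub (f : ℝ → ℝ) (x : ℝ) (K : ℕ) :
    ∑ k ∈ Finset.range K, eulerMaclaurinCoeff k * (newtonCoeff f k x - newtonCoeff f k (x + 1))
      = ∫ y in (0 : ℝ)..1,
          (1 / 2 - y) * ∑ k ∈ Finset.range (K + 1), rising k (-y) * newtonCoeff f k x := by
  have integrable (k : ℕ) : IntervalIntegrable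
      (fun y => newtonCoeff f k x * ((1 / 2 - y) * rising k (-y))) MeasureTheory.volume 0 1 :=
    Continuous.intervalIntegrable (by fun_prop) _ _
  have integrand_eq (y : ℝ) :
      (1 / 2 - y) * ∑ k ∈ Finset.range (K + 1), rising k (-y) * newtonCoeff f k x
        = ∑ k ∈ Finset.range (K + 1), newtonCoeff f k x * ((1 / 2 - y) * rising k (-y)) := by
    rw [Finset.mul_sum]
    exact Finset.sum_congr rfl fun k _ => by ring
  simp only [integrand_eq]
  rw [intervalIntegral.integral_finsetSum fun k _ => integrable k, Finset.sum_range_succ']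
  simp only [intervalIntegral.integral_const_mul, integral_half_sub_mul_rising_succ,
    integral_half_sub_mul_rising_zero, mul_zero, add_zero, ← succ_mul_newtonCoeff_succ]
  exact Finset.sum_congr rfl fun k _ => by ring

lemma tendsto_sum_eulerMaclaurinCoeff_mul_sub {f : ℝ → ℝ} {x : ℝ} {ε : ℕ → ℝ}
    (hf : ContinuousOn (fun y => f (x + y)) (Set.Icc 0 1)) (hε : Tendsto ε atTop (𝓝 0))
    (remainder_le : ∀ K, ∀ y ∈ Set.Icc (0 : ℝ) 1,
      |f (x + y) - ∑ k ∈ Finset.range (K + 1), rising k (-y) * newtonCoeff f k x| ≤ ε K) :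
    Tendsto (fun K => ∑ k ∈ Finset.range K,
        eulerMaclaurinCoeff k * (newtonCoeff f k x - newtonCoeff f k (x + 1)))
      atTop (𝓝 (∫ y in (0 : ℝ)..1, (1 / 2 - y) * f (x + y))) := by
  have integrable : IntervalIntegrable (fun y => (1 / 2 - y) * f (x + y))
      MeasureTheory.volume 0 1 := by
    rw [← Set.uIcc_of_le zero_le_one] at hf
    exact hf.intervalIntegrable.continuousOn_mul (by fun_prop)
  rw [tendsto_iff_norm_sub_tendsto_zero]
  refine squeeze_zero (fun K => norm_nonneg _) (fun K => ?_) hε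
  have integrable_sum : IntervalIntegrable (fun y =>
      (1 / 2 - y) * ∑ k ∈ Finset.range (K + 1), rising k (-y) * newtonCoeff f k x)
      MeasureTheory.volume 0 1 := Continuous.intervalIntegrable (by fun_prop) _ _
  rw [sum_eulerMaclaurinCoeff_mul_sub, norm_sub_rev,
    ← intervalIntegral.integral_sub integrable integrable_sum]
  simp only [← mul_sub]
  exact abs_integral_half_sub_mul_le (remainder_le K)

lemma abs_eulerMaclaurinCoeff_mul_le {x a r : ℝ} {k : ℕ} (hx : 1 ≤ x) (ha : 0 ≤ a)
    (hr : |r| ≤ a * (k + 1) / rising (k + 1) x) :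
    |eulerMaclaurinCoeff k * r| ≤ |eulerMaclaurinCoeff k| / k.factorial * (a / x) := by
  have x_ne_zero : x ≠ 0 := by positivity
  calc |eulerMaclaurinCoeff k * r|
      ≤ |eulerMaclaurinCoeff k| * (a * (k + 1) / ((k + 1).factorial * x)) := by
        rw [abs_mul]
        refine mul_le_mul_of_nonneg_left (hr.trans ?_) (abs_nonneg _)
        exact div_le_div_of_nonneg_left (by positivity) (by positivity)
          (factorial_succ_mul_le_rising k hx)
    _ = |eulerMaclaurinCoeff k| / k.factorial * (a / x) := by
        rw [Nat.factorial_succ]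
        push_cast
        field_simp

lemma summable_eulerMaclaurinCoeff_mul {x a : ℝ} {r : ℕ → ℝ} (hx : 1 ≤ x) (ha : 0 ≤ a)
    (hr : ∀ k, |r k| ≤ a * (k + 1) / rising (k + 1) x) :
    Summable fun k => eulerMaclaurinCoeff k * r k := by
  refine .of_norm_bounded (summable_abs_eulerMaclaurinCoeff_div_factorial.mul_right (a / x)) ?_
  exact fun k => abs_eulerMaclaurinCoeff_mul_le hx ha (hr k)

lemma abs_tsum_eulerMaclaurinCoeff_mul_le {x a : ℝ} {r : ℕ → ℝ} (hx : 1 ≤ x) (ha : 0 ≤ a)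
    (hr : ∀ k, |r k| ≤ a * (k + 1) / rising (k + 1) x) :
    |∑' k, eulerMaclaurinCoeff k * r k|
      ≤ (∑' k, |eulerMaclaurinCoeff k| / k.factorial) * (a / x) := by
  rw [← Real.norm_eq_abs, ← tsum_mul_right]
  exact tsum_of_norm_bounded (summable_abs_eulerMaclaurinCoeff_div_factorial.mul_right _).hasSum
    fun k => abs_eulerMaclaurinCoeff_mul_le hx ha (hr k)

lemma summable_eulerMaclaurinCoeff_div_rising {x : ℝ} (hx : 1 ≤ x) :
    Summable fun k => eulerMaclaurinCoeff k / rising (k + 1) x := by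
  simp only [div_eq_mul_one_div (eulerMaclaurinCoeff _)]
  refine summable_eulerMaclaurinCoeff_mul hx zero_le_one fun k => ?_
  have rising_pos := rising_pos (k + 1) (show 0 < x by linarith)
  rw [abs_of_pos (by positivity)]
  gcongr
  linarith [Nat.cast_nonneg (α := ℝ) k]

lemma abs_newtonCoeff_log_div_le_mul {x : ℝ} (hx : 1 ≤ x) (k : ℕ) :
    |newtonCoeff (fun v => Real.log v / v) k x|
      ≤ (Real.log x + 1) * (k + 1) / rising (k + 1) x := by
  refine (abs_newtonCoeff_log_div_le hx k).trans ?_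
  have log_nonneg := Real.log_nonneg hx
  have rising_nonneg := rising_nonneg (k + 1) (zero_le_one.trans hx)
  gcongr
  nlinarith [harmonic_cast_le k, mul_nonneg log_nonneg (Nat.cast_nonneg (α := ℝ) k)]

lemma summable_eulerMaclaurinCoeff_mul_newtonCoeff_log_div {x : ℝ} (hx : 1 ≤ x) :
    Summable fun k => eulerMaclaurinCoeff k * newtonCoeff (fun v => Real.log v / v) k x :=
  summable_eulerMaclaurinCoeff_mul hx (by linarith [Real.log_nonneg hx])
    (abs_newtonCoeff_log_div_le_mul hx)

lemma tendsto_tsum_eulerMaclaurinCoeff_mul_newtonCoeff_log_div :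
    Tendsto (fun x => ∑' k, eulerMaclaurinCoeff k * newtonCoeff (fun v => Real.log v / v) k x)
      atTop (𝓝 0) := by
  have tendsto_log_add_one_div : Tendsto (fun x => (Real.log x + 1) / x) atTop (𝓝 0) := by
    simpa [add_div] using Real.isLittleO_log_id_atTop.tendsto_div_nhds_zero.add
      tendsto_inv_atTop_zero
  have tendsto_bound := tendsto_log_add_one_div.const_mul
    (∑' k, |eulerMaclaurinCoeff k| / (k.factorial : ℝ))
  rw [mul_zero] at tendsto_bound
  refine squeeze_zero_norm' ?_ tendsto_bound
  filter_upwards [eventually_ge_atTop 1] with x hx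
  exact abs_tsum_eulerMaclaurinCoeff_mul_le hx (by linarith [Real.log_nonneg hx])
    (abs_newtonCoeff_log_div_le_mul hx)

lemma continuousOn_log_div_comp_add {x : ℝ} (hx : 0 < x) :
    ContinuousOn (fun y => Real.log (x + y) / (x + y)) (Set.Icc 0 1) := by
  have add_ne_zero (y : ℝ) (hy : y ∈ Set.Icc (0 : ℝ) 1) : x + y ≠ 0 := by linarith [hy.1]
  fun_prop (disch := assumption)

lemma integral_half_sub_mul_log_div {x : ℝ} (hx : 1 ≤ x) :
    ∫ y in (0 : ℝ)..1, (1 / 2 - y) * (Real.log (x + y) / (x + y))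
      = ∑' k, eulerMaclaurinCoeff k * newtonCoeff (fun v => Real.log v / v) k x
        - ∑' k, eulerMaclaurinCoeff k * newtonCoeff (fun v => Real.log v / v) k (x + 1) := by
  have tendsto_remainder :
      Tendsto (fun K : ℕ => (1 + Real.log x + harmonic K) / ((K : ℝ) + 1) / x) atTop (𝓝 0) := by
    have tendsto_log_div :=
      (tendsto_one_div_add_atTop_nhds_zero_nat (𝕜 := ℝ)).const_mul (1 + Real.log x)
    simpa [add_div, ← div_eq_mul_inv] using
      (tendsto_log_div.add tendsto_harmonic_div_succ).div_const x
  refine tendsto_nhds_unique (tendsto_sum_eulerMaclaurinCoeff_mul_sub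
    (f := fun v => Real.log v / v) (continuousOn_log_div_comp_add (by linarith)) tendsto_remainder
    fun K y hy => abs_log_div_sub_sum_rising_le hx hy K) ?_
  simp only [mul_sub]
  exact ((summable_eulerMaclaurinCoeff_mul_newtonCoeff_log_div hx).hasSum.sub
    (summable_eulerMaclaurinCoeff_mul_newtonCoeff_log_div (by linarith)).hasSum).tendsto_sum_nat

/-- The difference between `∑_{k ≤ n} (log k)²` and its trapezoidal approximation
`∫_0^n (log t)² dt + (log n)² / 2`. -/
noncomputable def logSqDefect (n : ℕ) : ℝ :=
  ∑ k ∈ Finset.Icc 1 n, Real.log k ^ 2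
    - (n * Real.log n ^ 2 - 2 * n * Real.log n + 2 * n + 1 / 2 * Real.log n ^ 2)

lemma hasDerivAt_trapezoid_log_sq {x y : ℝ} (hxy : x + y ≠ 0) :
    HasDerivAt (fun y => (1 / 2 - y) * Real.log (x + y) ^ 2
        + ((x + y) * Real.log (x + y) ^ 2 - 2 * ((x + y) * Real.log (x + y)) + 2 * (x + y)))
      (2 * ((1 / 2 - y) * (Real.log (x + y) / (x + y)))) y := by
  have hasDerivAt_add : HasDerivAt (fun y => x + y) 1 y := (hasDerivAt_id y).const_add x
  have hasDerivAt_log := hasDerivAt_add.log hxy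
  have hasDerivAt_half_sub : HasDerivAt (fun y : ℝ => 1 / 2 - y) (-1) y :=
    (hasDerivAt_id y).const_sub _
  refine ((hasDerivAt_half_sub.mul (hasDerivAt_log.pow 2)).add
    (((hasDerivAt_add.mul (hasDerivAt_log.pow 2)).sub
      ((hasDerivAt_add.mul hasDerivAt_log).const_mul 2)).add
        (hasDerivAt_add.const_mul 2))).congr_deriv ?_
  simp only [Pi.pow_apply]
  field_simp
  ring

lemma logSqDefect_sub_succ {n : ℕ} (hn : 1 ≤ n) :
    logSqDefect n - logSqDefect (n + 1)
      = 2 * ∫ y in (0 : ℝ)..1, (1 / 2 - y) * (Real.log (n + y) / (n + y)) := by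
  have n_pos : (0 : ℝ) < n := by exact_mod_cast hn
  have continuousOn_log_div := continuousOn_log_div_comp_add n_pos
  rw [← Set.uIcc_of_le zero_le_one] at continuousOn_log_div
  rw [← intervalIntegral.integral_const_mul, intervalIntegral.integral_eq_sub_of_hasDerivAt
    (fun y hy => hasDerivAt_trapezoid_log_sq (x := n) (y := y) ?_)
    (ContinuousOn.intervalIntegrable (by fun_prop))]
  · rw [logSqDefect, logSqDefect, Finset.sum_Icc_succ_top (by lia)]
    push_cast
    ring_nf
  · rw [Set.uIcc_of_le zero_le_one] at hy
    linarith [hy.1]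

lemma eq_add_of_sub_succ_eq_sub_succ {D V : ℕ → ℝ} {c : ℝ} {n : ℕ} (hD : Tendsto D atTop (𝓝 c))
    (hV : Tendsto V atTop (𝓝 0)) (h : ∀ m, n ≤ m → D m - D (m + 1) = V m - V (m + 1)) :
    D n = c + V n := by
  have sub_eq : ∀ m, n ≤ m → D m - V m = D n - V n := by
    intro m hm
    induction m, hm using Nat.le_induction with
    | base => rfl
    | succ m hm ih => linarith [h m hm]
  have limit_eq : c - 0 = D n - V n := tendsto_nhds_unique (hD.sub hV)
    (tendsto_const_nhds.congr' ((eventually_ge_atTop n).mono fun m hm => (sub_eq m hm).symm))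
  linarith

theorem logSqDefect_eq {c : ℝ} (hc : Tendsto logSqDefect atTop (𝓝 c)) {n : ℕ} (hn : 1 ≤ n) :
    logSqDefect n
      = c + 2 * ∑' k, eulerMaclaurinCoeff k * newtonCoeff (fun v => Real.log v / v) k n := by
  have tendsto_tsum := (tendsto_tsum_eulerMaclaurinCoeff_mul_newtonCoeff_log_div.comp
    tendsto_natCast_atTop_atTop).const_mul 2
  rw [mul_zero] at tendsto_tsum
  refine eq_add_of_sub_succ_eq_sub_succ hc tendsto_tsum fun m hm => ?_
  rw [logSqDefect_sub_succ (hn.trans hm),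
    integral_half_sub_mul_log_div (by exact_mod_cast hn.trans hm), mul_sub]
  simp only [Function.comp_apply, Nat.cast_add_one]

end EulerMaclaurin

section DoubleSeries

lemma summable_eulerMaclaurinCoeff_mul_harmonicMatrix {x : ℝ} (hx : 1 ≤ x) :
    Summable fun p : ℕ × ℕ =>
      eulerMaclaurinCoeff p.1 * (harmonicMatrix p.2 p.1 / rising (p.2 + 1) x) := by
  have hasSum_abs (k : ℕ) : HasSum
      (fun m => |eulerMaclaurinCoeff k * (harmonicMatrix m k / rising (m + 1) x)|)
      (|eulerMaclaurinCoeff k| * (newtonCoeffPlain k x + 2 * (harmonic k / rising (k + 1) x))) := by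
    simp only [abs_mul]
    exact (hasSum_abs_harmonicMatrix_div_rising hx k).mul_left _
  have row_sum_le (k : ℕ) : |newtonCoeffPlain k x + 2 * (harmonic k / rising (k + 1) x)|
      ≤ 3 * (k + 1) / rising (k + 1) x := by
    have x_pos : 0 < x := by linarith
    have rising_pos := rising_pos (k + 1) x_pos
    have harmonic_nonneg := harmonic_cast_nonneg k
    have harmonic_le := harmonic_cast_le k
    calc |newtonCoeffPlain k x + 2 * (harmonic k / rising (k + 1) x)|
        ≤ harmonic k / rising (k + 1) x + 2 * (harmonic k / rising (k + 1) x) :=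
          (abs_add_le _ _).trans
            (add_le_add (abs_newtonCoeffPlain_le x_pos k) (abs_of_nonneg (by positivity)).le)
      _ = 3 * harmonic k / rising (k + 1) x := by ring
      _ ≤ 3 * (k + 1) / rising (k + 1) x := by
          gcongr
          linarith
  refine Summable.of_norm ?_
  rw [summable_prod_of_nonneg fun p => norm_nonneg _]
  refine ⟨fun k => (hasSum_abs k).summable, ?_⟩
  refine Summable.of_nonneg_of_le (fun k => tsum_nonneg fun m => norm_nonneg _) (fun k => ?_)
    (summable_eulerMaclaurinCoeff_mul hx (by norm_num) row_sum_le).abs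
  rw [abs_mul]
  exact (hasSum_abs k).tsum_eq.trans_le
    (mul_le_mul_of_nonneg_left (le_abs_self _) (abs_nonneg _))

lemma hasSum_eulerMaclaurinCoeff_mul_harmonicMatrix (x : ℝ) (m : ℕ) :
    HasSum (fun k => eulerMaclaurinCoeff k * (harmonicMatrix m k / rising (m + 1) x))
      (momentFunctional bernoulliMoment (harmonicOperator (ascPochhammer ℝ m))
        / rising (m + 1) x) := by
  rw [momentFunctional_harmonicOperator_ascPochhammer, Finset.sum_div]
  simp only [mul_div_assoc]
  refine hasSum_sum_of_ne_finset_zero fun k hk => ?_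
  rw [harmonicMatrix_eq_zero (by simpa [Nat.lt_succ_iff] using hk), zero_div, mul_zero]

lemma hasSum_momentFunctional_harmonicOperator_div_rising {x : ℝ} (hx : 1 ≤ x) :
    HasSum (fun m => momentFunctional bernoulliMoment (harmonicOperator (ascPochhammer ℝ m))
        / rising (m + 1) x)
      (∑' k, eulerMaclaurinCoeff k * newtonCoeffPlain k x) := by
  have summable := summable_eulerMaclaurinCoeff_mul_harmonicMatrix hx
  have sum_rows := summable.hasSum.prod_fiberwise
    fun k => (hasSum_harmonicMatrix_div_rising hx k).mul_left (eulerMaclaurinCoeff k)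
  rw [sum_rows.tsum_eq]
  exact ((Equiv.prodComm ℕ ℕ).hasSum_iff.2 summable.hasSum).prod_fiberwise
    (hasSum_eulerMaclaurinCoeff_mul_harmonicMatrix x)

end DoubleSeries

section Coefficients

lemma ascPochhammer_coeff_eq_stirlingFirst (R : Type*) [CommSemiring R] (k l : ℕ) :
    (ascPochhammer R k).coeff l = Nat.stirlingFirst k l := by
  induction k generalizing l with
  | zero => cases l <;> simp [Polynomial.coeff_one]
  | succ k ih =>
    rw [ascPochhammer_succ_right, mul_add, Polynomial.coeff_add, ← Polynomial.C_eq_natCast,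
      Polynomial.coeff_mul_C, ih]
    cases l with
    | zero => cases k <;> simp
    | succ l =>
      rw [Polynomial.coeff_mul_X, ih, Nat.stirlingFirst_succ_succ]
      push_cast
      ring

lemma stirlingS_eq_stirlingFirst (k l : ℕ) :
    stirlingS k l = (-1) ^ (k + l) * Nat.stirlingFirst k l := by
  rw [stirlingS, ascPochhammer_coeff_eq_stirlingFirst]

lemma bernoulli_two_add_of_odd {l : ℕ} (hl : Odd l) : bernoulli (l + 2) = 0 :=
  bernoulli_eq_zero_of_odd (hl.add_even even_two) (by lia)

lemma bernoulli_four : bernoulli 4 = -1 / 30 := by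
  rw [bernoulli_eq_bernoulli'_of_ne_one (by norm_num), bernoulli'_four]

lemma bernoulli_six : bernoulli 6 = 1 / 42 := by
  have recurrence := sum_bernoulli 7
  simp only [Finset.sum_range_succ, Finset.sum_range_zero, bernoulli_zero, bernoulli_one,
    bernoulli_two, bernoulli_two_add_of_odd (l := 1) (by decide),
    bernoulli_two_add_of_odd (l := 3) (by decide), bernoulli_four] at recurrence
  norm_num [Nat.choose] at recurrence
  linarith

theorem plainCoeff_values : 2 * plainCoeff 1 = 0 ∧ 2 * plainCoeff 2 = 1 / 120 ∧
    2 * plainCoeff 3 = 1 / 40 ∧ 2 * plainCoeff 4 = 167 / 1890 ∧ 2 * plainCoeff 5 = 145 / 378 := by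
  refine ⟨?_, ?_, ?_, ?_, ?_⟩ <;>
  norm_num [plainCoeff, Finset.sum_Icc_succ_top, stirlingS_eq_stirlingFirst, Nat.stirlingFirst,
    Nat.factorial, bernoulli_four, bernoulli_six, bernoulli_eq_zero_of_odd, Nat.odd_iff]

theorem logCoeff_values : 2 * logCoeff 1 = 0 ∧ 2 * logCoeff 2 = -(1 / 180) ∧
    2 * logCoeff 3 = -(1 / 60) ∧ 2 * logCoeff 4 = -(5 / 84) ∧ 2 * logCoeff 5 = -(11 / 42) := by
  refine ⟨?_, ?_, ?_, ?_, ?_⟩ <;>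
  norm_num [logCoeff, Finset.sum_Icc_succ_top, stirlingS_eq_stirlingFirst, Nat.stirlingFirst,
    bernoulli_four, bernoulli_six, bernoulli_eq_zero_of_odd, Nat.odd_iff]

end Coefficients

section ConvergentEulerMaclaurin

lemma eulerMaclaurinCoeff_zero : eulerMaclaurinCoeff 0 = 1 / 12 := by
  rw [eulerMaclaurinCoeff, ascPochhammer_zero, ← Polynomial.monomial_zero_one,
    momentFunctional_monomial, bernoulliMoment]
  norm_num [bernoulli_two]

lemma harmonicOperator_ascPochhammer_zero : harmonicOperator (ascPochhammer ℝ 0) = 0 := by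
  rw [harmonicOperator_ascPochhammer, Finset.sum_range_one, harmonicMatrix_zero_right, zero_smul]

theorem hasSum_plainCoeff {n : ℕ} (hn : 1 ≤ n) :
    HasSum (fun k : ℕ => plainCoeff (k + 1) / risingProd n (k + 1))
      (∑' k, eulerMaclaurinCoeff k * newtonCoeffPlain k n) := by
  have hasSum_tail := (hasSum_nat_add_iff' 1).2
    (hasSum_momentFunctional_harmonicOperator_div_rising (x := n) (by exact_mod_cast hn))
  rw [Finset.sum_range_one, harmonicOperator_ascPochhammer_zero, map_zero, zero_div,
    sub_zero] at hasSum_tail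
  simpa only [plainCoeff_eq_momentFunctional (Nat.succ_ne_zero _), risingProd_eq_rising] using
    hasSum_tail

theorem hasSum_logCoeff {n : ℕ} (hn : 1 ≤ n) :
    HasSum (fun k : ℕ => logCoeff (k + 1) / risingProd n (k + 1))
      (∑' k, eulerMaclaurinCoeff k / rising (k + 1) n - 1 / (12 * n)) := by
  have hasSum_tail := (hasSum_nat_add_iff' 1).2
    (summable_eulerMaclaurinCoeff_div_rising (x := n) (by exact_mod_cast hn)).hasSum
  rw [Finset.sum_range_one, eulerMaclaurinCoeff_zero, rising_succ_left, rising_zero, mul_one,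
    div_div] at hasSum_tail
  simpa only [logCoeff_eq_momentFunctional (Nat.succ_ne_zero _), risingProd_eq_rising,
    eulerMaclaurinCoeff] using hasSum_tail

lemma tsum_eulerMaclaurinCoeff_mul_newtonCoeff_log_div {x : ℝ} (hx : 1 ≤ x) :
    ∑' k, eulerMaclaurinCoeff k * newtonCoeff (fun v => Real.log v / v) k x
      = Real.log x * ∑' k, eulerMaclaurinCoeff k / rising (k + 1) x
        + ∑' k, eulerMaclaurinCoeff k * newtonCoeffPlain k x := by
  have summable_plain : Summable fun k => eulerMaclaurinCoeff k * newtonCoeffPlain k x := by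
    refine summable_eulerMaclaurinCoeff_mul hx zero_le_one fun k => ?_
    have rising_nonneg := rising_nonneg (k + 1) (zero_le_one.trans hx)
    refine (abs_newtonCoeffPlain_le (zero_lt_one.trans_le hx) k).trans ?_
    gcongr
    linarith [harmonic_cast_le k]
  have split (k : ℕ) : eulerMaclaurinCoeff k * newtonCoeff (fun v => Real.log v / v) k x
      = Real.log x * (eulerMaclaurinCoeff k / rising (k + 1) x)
        + eulerMaclaurinCoeff k * newtonCoeffPlain k x := by
    rw [newtonCoeff_log_div_eq]
    ring
  simp only [split]
  rw [((summable_eulerMaclaurinCoeff_div_rising hx).mul_left _).tsum_add summable_plain,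
    tsum_mul_left]

theorem logSqDefect_eq_add_factorialSeries {c : ℝ} (hc : Tendsto logSqDefect atTop (𝓝 c)) {n : ℕ}
    (hn : 1 ≤ n) :
    logSqDefect n = Real.log n / (6 * n) + c
      + 2 * ∑' k : ℕ, plainCoeff (k + 1) / risingProd n (k + 1)
      + 2 * Real.log n * ∑' k : ℕ, logCoeff (k + 1) / risingProd n (k + 1) := by
  have n_ne_zero : (n : ℝ) ≠ 0 := by positivity
  rw [logSqDefect_eq hc hn, tsum_eulerMaclaurinCoeff_mul_newtonCoeff_log_div (by exact_mod_cast hn),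
    (hasSum_plainCoeff hn).tsum_eq, (hasSum_logCoeff hn).tsum_eq]
  field_simp
  ring

end ConvergentEulerMaclaurin

theorem mainTheorem10 :
    (∀ n : ℕ, 1 ≤ n →
      Summable (fun k : ℕ => plainCoeff (k + 1) / risingProd n (k + 1)) ∧
      Summable (fun k : ℕ => logCoeff (k + 1) / risingProd n (k + 1)) ∧
      ∑ k ∈ Finset.Icc 1 n, Real.log k ^ 2
        = n * Real.log n ^ 2 - 2 * n * Real.log n + 2 * n + 1 / 2 * Real.log n ^ 2
          + Real.log n / (6 * n)
          + (Real.eulerMascheroniConstant ^ 2 / 2 - Real.pi ^ 2 / 24 - Real.log 2 ^ 2 / 2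
              - Real.log 2 * Real.log Real.pi - Real.log Real.pi ^ 2 / 2 + stieltjesGammaOne)
          + 2 * ∑' k : ℕ, plainCoeff (k + 1) / risingProd n (k + 1)
          + 2 * Real.log n * ∑' k : ℕ, logCoeff (k + 1) / risingProd n (k + 1)) ∧
    (2 * plainCoeff 1 = 0 ∧ 2 * plainCoeff 2 = 1 / 120 ∧ 2 * plainCoeff 3 = 1 / 40 ∧
      2 * plainCoeff 4 = 167 / 1890 ∧ 2 * plainCoeff 5 = 145 / 378) ∧
    (2 * logCoeff 1 = 0 ∧ 2 * logCoeff 2 = -(1 / 180) ∧ 2 * logCoeff 3 = -(1 / 60) ∧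
      2 * logCoeff 4 = -(5 / 84) ∧ 2 * logCoeff 5 = -(11 / 42)) := by
  refine ⟨fun n hn => ⟨(hasSum_plainCoeff hn).summable, (hasSum_logCoeff hn).summable, ?_⟩,
    plainCoeff_values, logCoeff_values⟩
  have defect_eq := logSqDefect_eq_add_factorialSeries tendsto_sum_log_sq_sub hn
  rw [logSqDefect] at defect_eq
  linarith
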